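/- **Proposition 4.2.** Fix a dimension $n$ and $\lambda>0$. There is a function $c_1:\mathbb{R}\times\mathbb{R}\to(0,\infty)$, depending only on $n$ and $\lambda$, with the following property. Let $(M^n,g)$ be a connected, complete, noncompact smooth Riemannian manifold (without boundary), $q$ a smooth $(0,2)$-tensor field on $M$ and $f:M\to\mathbb{R}$ a smooth function with $\operatorname{Hess} f=\lambda g+\tfrac12 q$ (a shrinking gradient $q$-soliton). Assume that for some constant $C$ $$F:=\tfrac12|\nabla f|^2-\lambda f\le C \quad\text{on } M,$$ and that for every minimizing unit-speed geodesic $\gamma:[0,s_0]\to M$ and every nonnegative Lipschitz function $\varphi$ on $[0,s_0]$ with $\varphi(0)=\varphi(s_0)=0$ $$\int_0^{s_0}\varphi^2\Bigl(-\tfrac12 q(\gamma',\gamma')\Bigr)ds\le (n-1)\int_0^{s_0}|\varphi'|^2\,ds .$$ Then: 1. For every $x_0\in M$ and all real $K,G$ such that $|\tfrac12 q(v,v)|\le K|v|^2$ for all tangent vectors $v$ at points of the unit ball $B_{x_0}(1)$ and $|\nabla f|(x_0)\le G$, $$f(x)+\frac{C}{\lambda}\ \ge\ \frac{\lambda}{2}\,\bigl(\max\{r(x)-c_1(K,G),\,0\}\bigr)^2\qquad\text{for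 all }x\in M,\quad r(x)=d(x,x_0).$$ 2. The function $f$ attains its minimum, and there is a minimum point $x_0$ of $f$ such that, for every $K$ with $|\tfrac12 q(v,v)|\le K|v|^2$ on $B_{x_0}(1)$, this estimate holds with the constant $c_1(K,0)$; so for this base point $c_1$ depends only on $n$, $\lambda$ and the tensor $q$ on $B_{x_0}(1)$. In particular, if $f$ is normalized by an additive constant so that $F\le 0$, then $C=0$ is allowed and $f(x)\ge\frac{\lambda}{2}(r(x)-c_1)^2$ whenever $r(x)\ge c_1$. -/

import Mathlib

open Set MeasureTheory Bundle
open scoped Manifold ContDiff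

universe u

noncomputable section

namespace QSoliton

variable {n : ℕ} {M : Type*} [MetricSpace M] [ChartedSpace (EuclideanSpace ℝ (Fin n)) M]
  [IsManifold (𝓡 n) ∞ M]
  [RiemannianBundle (fun x : M => TangentSpace (𝓡 n) x)]

/-- The gradient `∇f` at `x`: the vector that represents the differential `df_x` with respect to
the Riemannian inner product of the tangent space. -/
def grad (f : M → ℝ) (x : M) : TangentSpace (𝓡 n) x :=
  haveI : FiniteDimensional ℝ (TangentSpace (𝓡 n) x) :=
    inferInstanceAs (FiniteDimensional ℝ (EuclideanSpace ℝ (Fin n)))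
  haveI : CompleteSpace (TangentSpace (𝓡 n) x) := FiniteDimensional.complete ℝ _
  (InnerProductSpace.toDual ℝ (TangentSpace (𝓡 n) x)).symm (mvfderiv (𝓡 n) f x)

/-- The Lie derivative of the metric,
`(L_X g)(Y, Z) = X (g(Y, Z)) - g([X, Y], Z) - g(Y, [X, Z])`, at the point `x`. -/
def lieDerivMetric (X Y Z : Π x : M, TangentSpace (𝓡 n) x) (x : M) : ℝ :=
  mvfderiv (𝓡 n) (fun y : M => inner ℝ (Y y) (Z y)) x (X x)
    - inner ℝ (VectorField.mlieBracket (𝓡 n) X Y x) (Z x)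
    - inner ℝ (Y x) (VectorField.mlieBracket (𝓡 n) X Z x)

/-- The Hessian of `f` for the Levi-Civita connection, evaluated on two vector fields:
`Hess f (Y, Z) = (1/2) (L_{∇f} g)(Y, Z)`. -/
def hess (f : M → ℝ) (Y Z : Π x : M, TangentSpace (𝓡 n) x) (x : M) : ℝ :=
  (1 / 2) * lieDerivMetric (grad (n := n) f) Y Z x

/-- `(M, g, f)` is a gradient `q`-soliton with constant `lam`: `f` is a smooth function, `q` a smooth
`(0,2)`-tensor field, and `Hess f = lam g + (1/2) q`. -/
structure IsGradientQSoliton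
    (q : Π x : M, TangentSpace (𝓡 n) x →L[ℝ] TangentSpace (𝓡 n) x →L[ℝ] ℝ)
    (f : M → ℝ) (lam : ℝ) : Prop where
  smooth_potential : ContMDiff (𝓡 n) 𝓘(ℝ, ℝ) ∞ f
  smooth_tensor :
    ContMDiff (𝓡 n)
      ((𝓡 n).prod 𝓘(ℝ, EuclideanSpace ℝ (Fin n) →L[ℝ] EuclideanSpace ℝ (Fin n) →L[ℝ] ℝ)) ∞
      (fun x : M => TotalSpace.mk'
        (EuclideanSpace ℝ (Fin n) →L[ℝ] EuclideanSpace ℝ (Fin n) →L[ℝ] ℝ) x (q x))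
  soliton_eq : ∀ (Y Z : Π x : M, TangentSpace (𝓡 n) x) (x : M),
    ContMDiffAt (𝓡 n) ((𝓡 n).prod (𝓡 n)) ∞
      (fun y : M => TotalSpace.mk' (EuclideanSpace ℝ (Fin n)) y (Y y)) x →
    ContMDiffAt (𝓡 n) ((𝓡 n).prod (𝓡 n)) ∞
      (fun y : M => TotalSpace.mk' (EuclideanSpace ℝ (Fin n)) y (Z y)) x →
    hess f Y Z x = lam * inner ℝ (Y x) (Z x) + (1 / 2) * q x (Y x) (Z x)

/-- `γ` restricted to `[0, s₀]` is a minimizing normal geodesic: it realizes the Riemannian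
distance between any two of its points and is parametrized by arc length. On a smooth Riemannian
manifold, such curves are exactly the minimizing unit-speed geodesics (and so are smooth). -/
def IsMinimizingNormalGeodesic {X : Type*} [MetricSpace X] (γ : ℝ → X) (s₀ : ℝ) : Prop :=
  ∀ s ∈ Icc 0 s₀, ∀ t ∈ Icc 0 s₀, dist (γ s) (γ t) = |s - t|

/-- The velocity `γ'(s)` of a curve defined on `[0, s₀]`. -/
def velocity (γ : ℝ → M) (s₀ s : ℝ) : TangentSpace (𝓡 n) (γ s) :=
  mfderivWithin 𝓘(ℝ, ℝ) (𝓡 n) γ (Icc 0 s₀) s (1 : ℝ)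

/-- The integral inequality
`∫₀^{s₀} φ² (-(1/2) q(γ', γ')) ds ≤ (n - 1) ∫₀^{s₀} |φ'|² ds`
along every minimizing normal geodesic `γ : [0, s₀] → M` and for every nonnegative Lipschitz
function `φ` on `[0, s₀]` that vanishes at the two ends. -/
def IntegralInequality
    (q : Π x : M, TangentSpace (𝓡 n) x →L[ℝ] TangentSpace (𝓡 n) x →L[ℝ] ℝ) : Prop :=
  ∀ (s₀ : ℝ) (γ : ℝ → M), 0 < s₀ → IsMinimizingNormalGeodesic γ s₀ →
    ∀ φ : ℝ → ℝ, (∃ L, LipschitzOnWith L φ (Icc 0 s₀)) → (∀ s ∈ Icc 0 s₀, 0 ≤ φ s) →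
      φ 0 = 0 → φ s₀ = 0 →
      ∫ s in (0 : ℝ)..s₀,
          φ s ^ 2 * (-(1 / 2) * q (γ s) (velocity (n := n) γ s₀ s) (velocity (n := n) γ s₀ s))
        ≤ ((n : ℝ) - 1) * ∫ s in (0 : ℝ)..s₀, |deriv φ s| ^ 2

/-- `|-(1/2) q| ≤ K` on the open unit ball around `x₀`, as quadratic forms. -/
def BoundedOnUnitBall
    (q : Π x : M, TangentSpace (𝓡 n) x →L[ℝ] TangentSpace (𝓡 n) x →L[ℝ] ℝ)
    (x₀ : M) (K : ℝ) : Prop :=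
  ∀ x ∈ Metric.ball x₀ 1, ∀ v : TangentSpace (𝓡 n) x, |-(1 / 2) * q x v v| ≤ K * ‖v‖ ^ 2

end QSoliton

end

/-!
# Quadratic growth of the potential of a shrinking gradient `q`-soliton

Put `w = f + C / lam`. The bound on `(1/2) |∇f|² - lam f` says `|∇w|² ≤ 2 lam w`, so `w ≥ 0` and
`√w` is `√(lam / 2)`-Lipschitz (`abs_sqrt_sub_sqrt_le`). This gives growth of `f` from above only;
the growth from below comes from the equation `h'' = lam + (1/2) q(γ', γ')` for `h = f ∘ γ` along a
minimizing geodesic `γ : [0, s₀] → M` from `x₀` to `x`. Tested against a function `ψ` that is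
`1` except near the ends, it reads `∫ ψ (lam + (1/2) q(γ', γ')) = - ∫ ψ' h'`. The integral
inequality bounds `- ∫ φ² (1/2) q(γ', γ')` by a constant for a cut-off function `φ` with
`φ² = ψ` away from the first unit interval, and on that interval `q` is bounded by assumption. The
contribution of `ψ' h'` at the start is controlled by `|∇f|(x₀)`; near the end
`|h'| ≤ |∇f| ≤ √(2 lam w)`, which by the Lipschitz bound is at most
`√(2 lam w(x)) + lam (s₀ - s)`. Altogether `lam s₀ ≤ √(2 lam w(x)) + const`
(`mul_sub_two_le_of_weakEquation`), which is the claim (`IsGradientQSoliton.growth`). In particular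
`f` is a proper function, so that it has a minimum, and there the gradient vanishes.

The geodesics here are metric objects, curves that realize the distance between any two of their
points, and the regularity theory that makes them smooth is not needed. Such a curve is
Lipschitz, hence differentiable almost everywhere, with unit velocity (`norm_velocity_eq_one`). The
equation for `f ∘ γ` holds in the weak sense: in a chart, the variation `γ + ε ψ ∇f` cannot
decrease the energy, because half of one plus the squared speed bounds the speed, hence the
distance, and equality holds at `ε = 0` (`first_variation`). The derivative of the energy at
`ε = 0` contains the coordinate expression of `2 Hess f (γ', γ')` (`two_mul_hess_coordField`), which
the soliton equation turns into `2 lam + q(γ', γ')`. The local equations are glued by cutting off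
the test functions (`WeakEquation.union`).

Existence of minimizing geodesics and compactness of closed balls are the theorem of Hopf–Rinow and
Cohn-Vossen for complete, locally compact length spaces (`HasAlmostGeodesics.properSpace`,
`HasAlmostGeodesics.exists_isMinimizingNormalGeodesic`).
-/

noncomputable section

namespace QSoliton

open Filter VectorField
open scoped Topology NNReal

/-! ### Coordinate vector fields and the metric in a chart -/

section Coordinates
variable {n : ℕ} {M : Type*} [MetricSpace M] [ChartedSpace (EuclideanSpace ℝ (Fin n)) M]

/-- `coordField p v` is the vector field on the domain of the chart at `p` whose coordinate
expression is the constant vector `v`. Off that domain it has no meaning. -/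
def coordField (p : M) (v : EuclideanSpace ℝ (Fin n)) (y : M) : TangentSpace (𝓡 n) y :=
  mpullback (𝓡 n) 𝓘(ℝ, EuclideanSpace ℝ (Fin n)) (extChartAt (𝓡 n) p) (fun _ => v) y

lemma coordField_add (p : M) (v w : EuclideanSpace ℝ (Fin n)) (y : M) :
    coordField p (v + w) y = coordField p v y + coordField p w y :=
  map_add (mfderiv (𝓡 n) 𝓘(ℝ, EuclideanSpace ℝ (Fin n)) (extChartAt (𝓡 n) p) y).inverse v w

lemma coordField_smul (p : M) (c : ℝ) (v : EuclideanSpace ℝ (Fin n)) (y : M) :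
    coordField p (c • v) y = c • coordField p v y :=
  map_smul (mfderiv (𝓡 n) 𝓘(ℝ, EuclideanSpace ℝ (Fin n)) (extChartAt (𝓡 n) p) y).inverse c v

variable [IsManifold (𝓡 n) ∞ M]

lemma contMDiffAt_coordField {p y : M} (hy : y ∈ (extChartAt (𝓡 n) p).source)
    (v : EuclideanSpace ℝ (Fin n)) :
    ContMDiffAt (𝓡 n) ((𝓡 n).prod (𝓡 n)) ∞
      (fun y : M => TotalSpace.mk' (EuclideanSpace ℝ (Fin n)) y (coordField p v y)) y := by
  refine ContMDiffAt.mpullback_vectorField_preimage (n := ∞) ?_ ?_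
    (isInvertible_mfderiv_extChartAt hy) (by simp)
  · exact contMDiffAt_vectorSpace_iff_contDiffAt.2 contDiffAt_const
  · exact contMDiffAt_extChartAt' (by simpa using hy)

lemma mfderiv_extChartAt_coordField {p y : M} (hy : y ∈ (extChartAt (𝓡 n) p).source)
    (v : EuclideanSpace ℝ (Fin n)) :
    mfderiv (𝓡 n) 𝓘(ℝ, EuclideanSpace ℝ (Fin n)) (extChartAt (𝓡 n) p) y (coordField p v y) = v :=
  (isInvertible_mfderiv_extChartAt hy).self_apply_inverse v

lemma coordField_mfderiv_extChartAt {p y : M} (hy : y ∈ (extChartAt (𝓡 n) p).source)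
    (w : TangentSpace (𝓡 n) y) :
    coordField p (mfderiv (𝓡 n) 𝓘(ℝ, EuclideanSpace ℝ (Fin n)) (extChartAt (𝓡 n) p) y w) y = w :=
  (isInvertible_mfderiv_extChartAt hy).inverse_apply_self w

lemma mdifferentiableAt_extChartAt_symm {p : M} {z : EuclideanSpace ℝ (Fin n)}
    (hz : z ∈ (extChartAt (𝓡 n) p).target) :
    MDifferentiableAt 𝓘(ℝ, EuclideanSpace ℝ (Fin n)) (𝓡 n) (extChartAt (𝓡 n) p).symm z := by
  have := mdifferentiableWithinAt_extChartAt_symm hz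
  simpa [mdifferentiableWithinAt_univ] using this

lemma mfderiv_extChartAt_symm {p : M} {z : EuclideanSpace ℝ (Fin n)}
    (hz : z ∈ (extChartAt (𝓡 n) p).target) (v : EuclideanSpace ℝ (Fin n)) :
    mfderiv 𝓘(ℝ, EuclideanSpace ℝ (Fin n)) (𝓡 n) (extChartAt (𝓡 n) p).symm z v
      = coordField p v ((extChartAt (𝓡 n) p).symm z) := by
  have hs := (extChartAt (𝓡 n) p).map_target hz
  have := mfderiv_extChartAt_comp_mfderivWithin_extChartAt_symm hz
  rw [show range (𝓡 n) = univ by simp, mfderivWithin_univ] at this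
  rw [← coordField_mfderiv_extChartAt hs
    (mfderiv 𝓘(ℝ, EuclideanSpace ℝ (Fin n)) (𝓡 n) (extChartAt (𝓡 n) p).symm z v)]
  congr 1
  exact congr($this v)

variable [RiemannianBundle (fun x : M => TangentSpace (𝓡 n) x)]

/-- The metric in the coordinates of the chart at `p`: the bilinear form `(g_{ij}(z))`. -/
def coordMetric (p : M) (z : EuclideanSpace ℝ (Fin n)) :
    EuclideanSpace ℝ (Fin n) →L[ℝ] EuclideanSpace ℝ (Fin n) →L[ℝ] ℝ :=
  LinearMap.toContinuousLinearMap
    ((LinearMap.toContinuousLinearMap (E := EuclideanSpace ℝ (Fin n)) (F' := ℝ)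
      (𝕜 := ℝ)).toLinearMap ∘ₗ
      LinearMap.mk₂ ℝ
        (fun v w => inner ℝ (coordField p v ((extChartAt (𝓡 n) p).symm z))
          (coordField p w ((extChartAt (𝓡 n) p).symm z)))
        (fun v v' w => by rw [coordField_add, inner_add_left])
        (fun c v w => by rw [coordField_smul, real_inner_smul_left]; rfl)
        (fun v w w' => by rw [coordField_add, inner_add_right])
        (fun c v w => by rw [coordField_smul, real_inner_smul_right]; rfl))

omit [IsManifold (𝓡 n) ∞ M] in
lemma coordMetric_apply (p : M) (z v w : EuclideanSpace ℝ (Fin n)) :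
    coordMetric p z v w = inner ℝ (coordField p v ((extChartAt (𝓡 n) p).symm z))
          (coordField p w ((extChartAt (𝓡 n) p).symm z)) := rfl

omit [IsManifold (𝓡 n) ∞ M] in
lemma coordMetric_self (p : M) (z v : EuclideanSpace ℝ (Fin n)) :
    coordMetric p z v v = ‖coordField p v ((extChartAt (𝓡 n) p).symm z)‖ ^ 2 := by
  rw [coordMetric_apply, real_inner_self_eq_norm_sq]

omit [IsManifold (𝓡 n) ∞ M] in
lemma coordMetric_comm (p : M) (z v w : EuclideanSpace ℝ (Fin n)) :
    coordMetric p z v w = coordMetric p z w v := by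
  rw [coordMetric_apply, coordMetric_apply, real_inner_comm]

variable [IsContMDiffRiemannianBundle (𝓡 n) ∞ (EuclideanSpace ℝ (Fin n))
          (fun x : M => TangentSpace (𝓡 n) x)]

lemma contDiffOn_coordMetric (p : M) :
    ContDiffOn ℝ ∞ (coordMetric p) (extChartAt (𝓡 n) p).target := by
  rw [contDiffOn_clm_apply]
  intro v
  rw [contDiffOn_clm_apply]
  intro w z hz
  have hs := (extChartAt (𝓡 n) p).map_target hz
  have h1 : ContMDiffAt (𝓡 n) 𝓘(ℝ, ℝ) ∞
      (fun y : M => (inner ℝ (coordField p v y) (coordField p w y) : ℝ))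
      ((extChartAt (𝓡 n) p).symm z) :=
    ContMDiffAt.inner_bundle (contMDiffAt_coordField hs v) (contMDiffAt_coordField hs w)
  have h2 := h1.comp z ((contMDiffOn_extChartAt_symm (n := ∞) p).contMDiffAt
    ((isOpen_extChartAt_target p).mem_nhds hz))
  exact h2.contDiffAt.contDiffWithinAt

end Coordinates

/-! ### The gradient, the Hessian and the soliton equation in a chart -/

section Gradient
variable {n : ℕ} {M : Type*} [MetricSpace M] [ChartedSpace (EuclideanSpace ℝ (Fin n)) M]
  [IsManifold (𝓡 n) ∞ M] [RiemannianBundle (fun x : M => TangentSpace (𝓡 n) x)]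

omit [IsManifold (𝓡 n) ∞ M] in
/-- The defining property of the gradient: `g(∇f, w) = df(w)`. -/
lemma inner_grad (f : M → ℝ) (x : M) (w : TangentSpace (𝓡 n) x) :
    inner ℝ (grad (n := n) f x) w = mvfderiv (𝓡 n) f x w := by
  have : FiniteDimensional ℝ (TangentSpace (𝓡 n) x) :=
    inferInstanceAs (FiniteDimensional ℝ (EuclideanSpace ℝ (Fin n)))
  have : CompleteSpace (TangentSpace (𝓡 n) x) := FiniteDimensional.complete ℝ _
  exact InnerProductSpace.toDual_symm_apply

/-- The coordinate expression of `∇f` in the chart at `p`. -/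
def coordGrad (p : M) (f : M → ℝ) (z : EuclideanSpace ℝ (Fin n)) : EuclideanSpace ℝ (Fin n) :=
  mpullback 𝓘(ℝ, EuclideanSpace ℝ (Fin n)) (𝓡 n) (extChartAt (𝓡 n) p).symm (grad (n := n) f) z

omit [RiemannianBundle (fun x : M => TangentSpace (𝓡 n) x)] in
lemma isInvertible_mfderiv_extChartAt_symm {p : M} {z : EuclideanSpace ℝ (Fin n)}
    (hz : z ∈ (extChartAt (𝓡 n) p).target) :
    (mfderiv 𝓘(ℝ, EuclideanSpace ℝ (Fin n)) (𝓡 n) (extChartAt (𝓡 n) p).symm z).IsInvertible := by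
  have := isInvertible_mfderivWithin_extChartAt_symm hz
  rwa [show range (𝓡 n) = univ by simp, mfderivWithin_univ] at this

lemma coordField_coordGrad {p : M} {z : EuclideanSpace ℝ (Fin n)}
    (hz : z ∈ (extChartAt (𝓡 n) p).target) (f : M → ℝ) :
    coordField p (coordGrad p f z) ((extChartAt (𝓡 n) p).symm z)
      = grad (n := n) f ((extChartAt (𝓡 n) p).symm z) := by
  rw [← mfderiv_extChartAt_symm hz]
  exact (isInvertible_mfderiv_extChartAt_symm hz).self_apply_inverse _

omit [RiemannianBundle (fun x : M => TangentSpace (𝓡 n) x)] in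
lemma fderiv_comp_extChartAt_symm {p : M} {z : EuclideanSpace ℝ (Fin n)}
    (hz : z ∈ (extChartAt (𝓡 n) p).target) {f : M → ℝ}
    (hf : MDifferentiableAt (𝓡 n) 𝓘(ℝ, ℝ) f ((extChartAt (𝓡 n) p).symm z))
    (w : EuclideanSpace ℝ (Fin n)) :
    fderiv ℝ (f ∘ (extChartAt (𝓡 n) p).symm) z w
      = mvfderiv (𝓡 n) f ((extChartAt (𝓡 n) p).symm z)
          (coordField p w ((extChartAt (𝓡 n) p).symm z)) := by
  have h := mfderiv_comp z hf (mdifferentiableAt_extChartAt_symm hz)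
  rw [← mfderiv_extChartAt_symm hz, ← mfderiv_eq_fderiv, h]
  rfl

lemma coordMetric_coordGrad {p : M} {z : EuclideanSpace ℝ (Fin n)}
    (hz : z ∈ (extChartAt (𝓡 n) p).target) {f : M → ℝ}
    (hf : MDifferentiableAt (𝓡 n) 𝓘(ℝ, ℝ) f ((extChartAt (𝓡 n) p).symm z))
    (w : EuclideanSpace ℝ (Fin n)) :
    coordMetric p z (coordGrad p f z) w = fderiv ℝ (f ∘ (extChartAt (𝓡 n) p).symm) z w := by
  rw [coordMetric_apply, coordField_coordGrad hz, inner_grad, fderiv_comp_extChartAt_symm hz hf]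

omit [RiemannianBundle (fun x : M => TangentSpace (𝓡 n) x)] in
lemma coordField_eq_zero {p y : M} (hy : y ∈ (extChartAt (𝓡 n) p).source)
    {v : EuclideanSpace ℝ (Fin n)} (h : coordField p v y = 0) : v = 0 := by
  rw [← mfderiv_extChartAt_coordField hy v, h]
  exact map_zero _

lemma isInvertible_coordMetric {p : M} {z : EuclideanSpace ℝ (Fin n)}
    (hz : z ∈ (extChartAt (𝓡 n) p).target) : (coordMetric p z).IsInvertible := by
  have hinj : Function.Injective (coordMetric p z).toLinearMap := by
    rw [injective_iff_map_eq_zero]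
    intro v hv
    have h0 : coordMetric p z v v = 0 := by
      have : coordMetric p z v = 0 := hv
      rw [this]; rfl
    rw [coordMetric_self] at h0
    exact coordField_eq_zero ((extChartAt (𝓡 n) p).map_target hz)
      (norm_eq_zero.1 (pow_eq_zero_iff two_ne_zero |>.1 h0))
  have hdim : Module.finrank ℝ (EuclideanSpace ℝ (Fin n))
      = Module.finrank ℝ (EuclideanSpace ℝ (Fin n) →L[ℝ] ℝ) := by
    rw [← (LinearMap.toContinuousLinearMap (𝕜 := ℝ) (E := EuclideanSpace ℝ (Fin n))
      (F' := ℝ)).finrank_eq]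
    exact (Subspace.dual_finrank_eq).symm
  let e := LinearEquiv.ofInjectiveOfFinrankEq (coordMetric p z).toLinearMap hinj hdim
  refine ⟨e.toContinuousLinearEquiv, ?_⟩
  ext v w
  rfl

variable [IsContMDiffRiemannianBundle (𝓡 n) ∞ (EuclideanSpace ℝ (Fin n))
          (fun x : M => TangentSpace (𝓡 n) x)]

omit [RiemannianBundle (fun x : M => TangentSpace (𝓡 n) x)] [IsContMDiffRiemannianBundle (𝓡 n) ∞
    (EuclideanSpace ℝ (Fin n)) (fun x : M => TangentSpace (𝓡 n) x)] in
lemma contDiffOn_comp_extChartAt_symm (p : M) {f : M → ℝ}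
    (hf : ContMDiff (𝓡 n) 𝓘(ℝ, ℝ) ∞ f) :
    ContDiffOn ℝ ∞ (f ∘ (extChartAt (𝓡 n) p).symm) (extChartAt (𝓡 n) p).target := by
  rw [← contMDiffOn_iff_contDiffOn]
  exact hf.comp_contMDiffOn (contMDiffOn_extChartAt_symm p)

/-- The coordinates of the gradient are smooth, because they solve the linear system
`g(∇f, ·) = df`. -/
lemma contDiffOn_coordGrad (p : M) {f : M → ℝ} (hf : ContMDiff (𝓡 n) 𝓘(ℝ, ℝ) ∞ f) :
    ContDiffOn ℝ ∞ (coordGrad p f) (extChartAt (𝓡 n) p).target := by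
  intro z hz
  have hnhds := (isOpen_extChartAt_target (I := 𝓡 n) p).mem_nhds hz
  have h1 : ContDiffAt ℝ ∞ (fun z => (coordMetric p z).inverse) z :=
    ((isInvertible_coordMetric hz).contDiffAt_map_inverse).comp z
      ((contDiffOn_coordMetric p).contDiffAt hnhds)
  have h2 : ContDiffAt ℝ ∞ (fun z => fderiv ℝ (f ∘ (extChartAt (𝓡 n) p).symm) z) z :=
    ((contDiffOn_comp_extChartAt_symm p hf).contDiffAt hnhds).fderiv_right (by simp)
  refine ((h1.clm_apply h2).congr_of_eventuallyEq ?_).contDiffWithinAt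
  filter_upwards [hnhds] with z' hz'
  have : fderiv ℝ (f ∘ (extChartAt (𝓡 n) p).symm) z' = coordMetric p z' (coordGrad p f z') := by
    ext w
    rw [coordMetric_coordGrad hz' (hf.mdifferentiable (by simp) _)]
  rw [this, (isInvertible_coordMetric hz').inverse_apply_self]

lemma contMDiffAt_grad {f : M → ℝ} (hf : ContMDiff (𝓡 n) 𝓘(ℝ, ℝ) ∞ f) (p : M) {y : M}
    (hy : y ∈ (extChartAt (𝓡 n) p).source) :
    ContMDiffAt (𝓡 n) ((𝓡 n).prod (𝓡 n)) ∞
      (fun y : M => TotalSpace.mk' (EuclideanSpace ℝ (Fin n)) y (grad (n := n) f y)) y := by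
  have h : ContMDiffAt (𝓡 n) ((𝓡 n).prod (𝓡 n)) ∞
      (fun y : M => TotalSpace.mk' (EuclideanSpace ℝ (Fin n)) y
        (mpullback (𝓡 n) 𝓘(ℝ, EuclideanSpace ℝ (Fin n)) (extChartAt (𝓡 n) p)
          (coordGrad p f) y)) y := by
    refine ContMDiffAt.mpullback_vectorField_preimage (n := ∞) ?_
      (contMDiffAt_extChartAt' (by simpa using hy))
      (isInvertible_mfderiv_extChartAt hy) (by simp)
    exact contMDiffAt_vectorSpace_iff_contDiffAt.2 ((contDiffOn_coordGrad p hf).contDiffAt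
      ((isOpen_extChartAt_target (I := 𝓡 n) p).mem_nhds ((extChartAt (𝓡 n) p).map_source hy)))
  refine h.congr_of_eventuallyEq ?_
  filter_upwards [(isOpen_extChartAt_source (I := 𝓡 n) p).mem_nhds hy] with y' hy'
  have := coordField_coordGrad ((extChartAt (𝓡 n) p).map_source hy') f
  rw [(extChartAt (𝓡 n) p).left_inv hy'] at this
  rw [← this]
  rfl

/-- The Hessian in coordinates: `2 Hess f (v, v) = (∂_{∇f} g)(v, v) + 2 g(∂_v ∇f, v)`. -/
lemma two_mul_hess_coordField {f : M → ℝ} (hf : ContMDiff (𝓡 n) 𝓘(ℝ, ℝ) ∞ f) {p : M}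
    {z : EuclideanSpace ℝ (Fin n)} (hz : z ∈ (extChartAt (𝓡 n) p).target)
    (v : EuclideanSpace ℝ (Fin n)) :
    2 * hess f (coordField p v) (coordField p v) ((extChartAt (𝓡 n) p).symm z)
      = fderiv ℝ (coordMetric p) z (coordGrad p f z) v v
        + 2 * coordMetric p z (fderiv ℝ (coordGrad p f) z v) v := by
  have hs := (extChartAt (𝓡 n) p).map_target hz
  have hnhds := (isOpen_extChartAt_target (I := 𝓡 n) p).mem_nhds hz
  set y := (extChartAt (𝓡 n) p).symm z with hy
  have hG : DifferentiableAt ℝ (coordMetric p) z :=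
    ((contDiffOn_coordMetric p).contDiffAt hnhds).differentiableAt (by simp)
  have hv := contMDiffAt_coordField hs v
  have hfirst : mvfderiv (𝓡 n) (fun y : M => (inner ℝ (coordField p v y) (coordField p v y) : ℝ)) y
      (grad (n := n) f y) = fderiv ℝ (coordMetric p) z (coordGrad p f z) v v := by
    have hd : MDifferentiableAt (𝓡 n) 𝓘(ℝ, ℝ)
        (fun y : M => (inner ℝ (coordField p v y) (coordField p v y) : ℝ)) y :=
      (ContMDiffAt.inner_bundle hv hv).mdifferentiableAt (by simp)
    have h := fderiv_comp_extChartAt_symm hz hd (coordGrad p f z)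
    rw [coordField_coordGrad hz] at h
    rw [← h]
    have h2 := (hG.hasFDerivAt.clm_apply (hasFDerivAt_const v z)).clm_apply (hasFDerivAt_const v z)
    refine congr($(h2.fderiv) (coordGrad p f z)).trans ?_
    simp
  have hbr : mlieBracket (𝓡 n) (grad (n := n) f) (coordField p v) y
      = coordField p (-(fderiv ℝ (coordGrad p f) z v)) y := by
    have : IsManifold (𝓡 n) (minSmoothness ℝ 2) M := by
      rw [minSmoothness_of_isRCLikeNormedField]
      infer_instance
    have h := mpullback_mlieBracket (I := 𝓘(ℝ, EuclideanSpace ℝ (Fin n))) (n := ∞)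
      (f := (extChartAt (𝓡 n) p).symm) (x₀ := z) (V := grad (n := n) f) (W := coordField p v)
      ((contMDiffAt_grad hf p hs).mdifferentiableAt (by simp)) (hv.mdifferentiableAt (by simp))
      ((contMDiffOn_extChartAt_symm (n := ∞) p).contMDiffAt hnhds)
      (by rw [minSmoothness_of_isRCLikeNormedField]; exact ENat.LEInfty.out)
    have h2 : mlieBracket 𝓘(ℝ, EuclideanSpace ℝ (Fin n))
        (mpullback 𝓘(ℝ, EuclideanSpace ℝ (Fin n)) (𝓡 n) (extChartAt (𝓡 n) p).symm
          (grad (n := n) f))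
        (mpullback 𝓘(ℝ, EuclideanSpace ℝ (Fin n)) (𝓡 n) (extChartAt (𝓡 n) p).symm
          (coordField p v)) z = -(fderiv ℝ (coordGrad p f) z v) := by
      have h3 : mpullback 𝓘(ℝ, EuclideanSpace ℝ (Fin n)) (𝓡 n) (extChartAt (𝓡 n) p).symm
          (coordField p v) =ᶠ[𝓝 z] fun _ => v := by
        filter_upwards [hnhds] with z' hz'
        rw [mpullback_apply]
        have := mfderiv_extChartAt_symm hz' v
        rw [← this]
        exact (isInvertible_mfderiv_extChartAt_symm hz').inverse_apply_self v
      refine (EventuallyEq.rfl.mlieBracket_vectorField_eq h3).trans ?_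
      have h4 : ∀ V W : Π z : EuclideanSpace ℝ (Fin n),
          TangentSpace 𝓘(ℝ, EuclideanSpace ℝ (Fin n)) z,
          mlieBracket 𝓘(ℝ, EuclideanSpace ℝ (Fin n)) V W = lieBracket ℝ V W := by
        intro V W
        rw [← mlieBracketWithin_univ, mlieBracketWithin_eq_lieBracketWithin]
        exact lieBracketWithin_univ (V := fun z => (V z : EuclideanSpace ℝ (Fin n)))
          (W := fun z => (W z : EuclideanSpace ℝ (Fin n)))
      refine (congr_fun (h4 _ _) z).trans ?_
      have h5 : ∀ V : EuclideanSpace ℝ (Fin n) → EuclideanSpace ℝ (Fin n),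
          lieBracket ℝ V (fun _ => v) z = -(fderiv ℝ V z v) := by
        intro V
        simp [lieBracket]
      exact h5 _
    rw [h2] at h
    rw [← h]
    refine Eq.trans ?_ (mfderiv_extChartAt_symm hz _)
    exact ((isInvertible_mfderiv_extChartAt_symm hz).self_apply_inverse _).symm
  rw [hess, lieDerivMetric, hfirst, hbr, coordMetric_apply]
  have hneg : coordField p (-(fderiv ℝ (coordGrad p f) z v)) y
      = -coordField p (fderiv ℝ (coordGrad p f) z v) y := by
    rw [← neg_one_smul ℝ, coordField_smul, neg_one_smul]
  rw [hneg, inner_neg_left, inner_neg_right, real_inner_comm]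
  ring

/-- A `(0,2)`-tensor in the coordinates of the chart at `p`. -/
def coordTensor (p : M)
    (q : Π x : M, TangentSpace (𝓡 n) x →L[ℝ] TangentSpace (𝓡 n) x →L[ℝ] ℝ)
    (z : EuclideanSpace ℝ (Fin n)) :
    EuclideanSpace ℝ (Fin n) →L[ℝ] EuclideanSpace ℝ (Fin n) →L[ℝ] ℝ :=
  LinearMap.toContinuousLinearMap
    ((LinearMap.toContinuousLinearMap (E := EuclideanSpace ℝ (Fin n)) (F' := ℝ)
      (𝕜 := ℝ)).toLinearMap ∘ₗ
      LinearMap.mk₂ ℝ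
        (fun v w => q ((extChartAt (𝓡 n) p).symm z) (coordField p v ((extChartAt (𝓡 n) p).symm z))
          (coordField p w ((extChartAt (𝓡 n) p).symm z)))
        (fun v v' w => by rw [coordField_add, map_add]; rfl)
        (fun c v w => by rw [coordField_smul, map_smul]; rfl)
        (fun v w w' => by rw [coordField_add, map_add])
        (fun c v w => by rw [coordField_smul, map_smul]))

omit [IsManifold (𝓡 n) ∞ M] [RiemannianBundle (fun x : M => TangentSpace (𝓡 n) x)]
    [IsContMDiffRiemannianBundle (𝓡 n) ∞
    (EuclideanSpace ℝ (Fin n)) (fun x : M => TangentSpace (𝓡 n) x)] in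
lemma coordTensor_apply (p : M)
    (q : Π x : M, TangentSpace (𝓡 n) x →L[ℝ] TangentSpace (𝓡 n) x →L[ℝ] ℝ)
    (z v w : EuclideanSpace ℝ (Fin n)) :
    coordTensor p q z v w = q ((extChartAt (𝓡 n) p).symm z)
      (coordField p v ((extChartAt (𝓡 n) p).symm z))
      (coordField p w ((extChartAt (𝓡 n) p).symm z)) := rfl

variable {q : Π x : M, TangentSpace (𝓡 n) x →L[ℝ] TangentSpace (𝓡 n) x →L[ℝ] ℝ} {f : M → ℝ}
  {lam : ℝ}

omit [IsContMDiffRiemannianBundle (𝓡 n) ∞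
    (EuclideanSpace ℝ (Fin n)) (fun x : M => TangentSpace (𝓡 n) x)] in
lemma IsGradientQSoliton.continuousOn_coordTensor (h : IsGradientQSoliton q f lam) (p : M) :
    ContinuousOn (coordTensor p q) (extChartAt (𝓡 n) p).target := by
  rw [continuousOn_clm_apply]
  intro v
  rw [continuousOn_clm_apply]
  intro w z hz
  have hs := (extChartAt (𝓡 n) p).map_target hz
  have h1 := ContMDiffAt.clm_bundle_apply₂ (F₁ := EuclideanSpace ℝ (Fin n))
    (F₂ := EuclideanSpace ℝ (Fin n)) (E₁ := fun x : M => TangentSpace (𝓡 n) x)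
    (E₂ := fun x : M => TangentSpace (𝓡 n) x) (E₃ := Bundle.Trivial M ℝ)
    (F₃ := ℝ) (b := fun x : M => x)
    (h.smooth_tensor.contMDiffAt (x := (extChartAt (𝓡 n) p).symm z))
    (contMDiffAt_coordField hs v) (contMDiffAt_coordField hs w)
  have h2 : ContMDiffAt (𝓡 n) 𝓘(ℝ, ℝ) ∞
      (fun y : M => q y (coordField p v y) (coordField p w y)) ((extChartAt (𝓡 n) p).symm z) := by
    simp only [contMDiffAt_totalSpace] at h1
    exact h1.2
  exact (h2.continuousAt.comp (continuousAt_extChartAt_symm'' hz)).continuousWithinAt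

/-- The soliton equation `Hess f = lam g + (1/2) q` in coordinates. -/
lemma IsGradientQSoliton.coord_eq (h : IsGradientQSoliton q f lam) {p : M}
    {z : EuclideanSpace ℝ (Fin n)} (hz : z ∈ (extChartAt (𝓡 n) p).target)
    (v : EuclideanSpace ℝ (Fin n)) :
    fderiv ℝ (coordMetric p) z (coordGrad p f z) v v
        + 2 * coordMetric p z (fderiv ℝ (coordGrad p f) z v) v
      = 2 * lam * coordMetric p z v v + coordTensor p q z v v := by
  have hs := (extChartAt (𝓡 n) p).map_target hz
  rw [← two_mul_hess_coordField h.smooth_potential hz, h.soliton_eq _ _ _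
    (contMDiffAt_coordField hs v) (contMDiffAt_coordField hs v), coordMetric_apply,
    coordTensor_apply]
  ring

end Gradient

/-! ### Distances and lengths of paths -/

section Distance
variable {n : ℕ} {M : Type*} [MetricSpace M] [ChartedSpace (EuclideanSpace ℝ (Fin n)) M]
  [IsManifold (𝓡 n) ∞ M] [RiemannianBundle (fun x : M => TangentSpace (𝓡 n) x)]
  [IsRiemannianManifold (𝓡 n) M]

omit [IsManifold (𝓡 n) ∞ M] in
/-- Any two points are joined by `C^1` paths whose length is close to the distance; all pieces of
such a path have length at least the distance of their end points. -/
lemma exists_path_lt (x y : M) {r : ℝ} (hr : dist x y < r) :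
    ∃ γ : ℝ → M, γ 0 = x ∧ γ 1 = y ∧ ContMDiff 𝓘(ℝ, ℝ) (𝓡 n) 1 γ ∧
      Manifold.pathELength (𝓡 n) γ 0 1 < ENNReal.ofReal r := by
  have h : Manifold.riemannianEDist (𝓡 n) x y < ENNReal.ofReal r := by
    rw [← IsRiemannianManifold.out (I := 𝓡 n) x y, edist_dist]
    exact (ENNReal.ofReal_lt_ofReal_iff (dist_nonneg.trans_lt hr)).2 hr
  obtain ⟨γ, h0, h1, hγ, hl, -⟩ :=
    Manifold.exists_lt_locally_constant_of_riemannianEDist_lt h zero_lt_one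
  exact ⟨γ, h0, h1, hγ, hl⟩

omit [IsManifold (𝓡 n) ∞ M] in
lemma edist_le_pathELength {γ : ℝ → M} (hγ : ContMDiff 𝓘(ℝ, ℝ) (𝓡 n) 1 γ) {s t : ℝ}
    (hst : s ≤ t) : edist (γ s) (γ t) ≤ Manifold.pathELength (𝓡 n) γ s t := by
  rw [IsRiemannianManifold.out (I := 𝓡 n)]
  exact Manifold.riemannianEDist_le_pathELength hγ.contMDiffOn rfl rfl hst

omit [IsManifold (𝓡 n) ∞ M] in
/-- A function whose differential is bounded by `c` on a ball is `c`-Lipschitz for pairs of points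
that can be joined by almost minimizing paths inside the ball. -/
lemma norm_sub_le_mul_dist {F : Type*} [NormedAddCommGroup F] [NormedSpace ℝ F] {u : M → F}
    {x : M} {r c : ℝ} (hc0 : 0 ≤ c)
    (hu : ∀ y ∈ Metric.ball x r, ContMDiffAt (𝓡 n) 𝓘(ℝ, F) 1 u y)
    (hc : ∀ y ∈ Metric.ball x r, ∀ w : TangentSpace (𝓡 n) y,
      ‖mvfderiv (𝓡 n) u y w‖ ≤ c * ‖w‖)
    {y y' : M} (hy : dist y x + dist y y' < r) : ‖u y' - u y‖ ≤ c * dist y y' := by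
  have key : ∀ d, dist y y' < d → dist y x + d < r → ‖u y' - u y‖ ≤ c * d := by
    intro d hd hdr
    have hd0 : 0 ≤ d := dist_nonneg.trans hd.le
    obtain ⟨γ, h0, h1, hγ, hl⟩ := exists_path_lt (n := n) y y' hd
    have hmem : ∀ t ∈ Icc (0 : ℝ) 1, γ t ∈ Metric.ball x r := by
      intro t ht
      have h2 : edist (γ 0) (γ t) < ENNReal.ofReal d :=
        ((edist_le_pathELength hγ ht.1).trans (Manifold.pathELength_mono le_rfl ht.2)).trans_lt hl
      rw [h0, edist_dist] at h2
      have h3 : dist y (γ t) < d := (ENNReal.ofReal_lt_ofReal_iff_of_nonneg dist_nonneg).1 h2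
      rw [Metric.mem_ball]
      have := dist_triangle (γ t) y x
      rw [dist_comm (γ t) y] at this
      linarith
    have hcd : ContDiffOn ℝ 1 (u ∘ γ) (Icc 0 1) := by
      intro t ht
      exact (((hu _ (hmem t ht)).comp t hγ.contMDiffAt).contDiffAt).contDiffWithinAt
    have h2 := enorm_sub_le_lintegral_derivWithin_Icc_of_contDiffOn_Icc hcd zero_le_one
    have h3 : ∫⁻ t in Icc (0 : ℝ) 1, ‖derivWithin (u ∘ γ) (Icc 0 1) t‖ₑ
        ≤ ∫⁻ t in Icc (0 : ℝ) 1,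
          ENNReal.ofReal c * ‖mfderiv 𝓘(ℝ, ℝ) (𝓡 n) γ t (1 : ℝ)‖ₑ := by
      refine setLIntegral_mono' measurableSet_Icc fun t ht => ?_
      have hut := hu _ (hmem t ht)
      have hdiff : DifferentiableAt ℝ (u ∘ γ) t :=
        ((hut.comp t hγ.contMDiffAt).contDiffAt).differentiableAt one_ne_zero
      rw [hdiff.derivWithin (uniqueDiffOn_Icc zero_lt_one t ht)]
      have h4 : deriv (u ∘ γ) t
          = mvfderiv (𝓡 n) u (γ t) (mfderiv 𝓘(ℝ, ℝ) (𝓡 n) γ t (1 : ℝ)) := by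
        rw [← fderiv_apply_one_eq_deriv, ← mfderiv_eq_fderiv,
          mfderiv_comp t (hut.mdifferentiableAt one_ne_zero)
            (hγ.contMDiffAt.mdifferentiableAt one_ne_zero)]
        rfl
      rw [h4, ← ofReal_norm, ← ofReal_norm, ← ENNReal.ofReal_mul hc0]
      exact ENNReal.ofReal_le_ofReal (hc _ (hmem t ht) _)
    have h5 : ‖(u ∘ γ) 1 - (u ∘ γ) 0‖ₑ ≤ ENNReal.ofReal (c * d) := by
      refine (h2.trans h3).trans ?_
      rw [lintegral_const_mul' _ _ ENNReal.ofReal_ne_top, ENNReal.ofReal_mul hc0]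
      gcongr
      exact Manifold.pathELength_eq_lintegral_mfderiv_Icc.symm.le.trans hl.le
    simp only [Function.comp_apply, h0, h1] at h5
    rw [← ofReal_norm] at h5
    exact (ENNReal.ofReal_le_ofReal_iff (by positivity)).1 h5
  have hlim : Tendsto (fun d => c * d) (𝓝[>] (dist y y')) (𝓝 (c * dist y y')) :=
    (tendsto_const_nhds.mul tendsto_id).mono_left nhdsWithin_le_nhds
  refine ge_of_tendsto hlim ?_
  have : ∀ᶠ d in 𝓝[>] (dist y y'), d < r - dist y x :=
    nhdsWithin_le_nhds (Iio_mem_nhds (lt_sub_iff_add_lt'.2 hy))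
  filter_upwards [this, self_mem_nhdsWithin] with d hd hd'
  exact key d hd' (by linarith)

/-- The distance is bounded by the length of the coordinate segment. -/
lemma dist_extChartAt_symm_le {p : M} {z z' : EuclideanSpace ℝ (Fin n)} {b : ℝ} (hb : 0 ≤ b)
    (hseg : segment ℝ z z' ⊆ (extChartAt (𝓡 n) p).target)
    (h : ∀ y ∈ segment ℝ z z', coordMetric p y (z' - z) (z' - z) ≤ b ^ 2) :
    dist ((extChartAt (𝓡 n) p).symm z) ((extChartAt (𝓡 n) p).symm z') ≤ b := by
  let η := ContinuousAffineMap.lineMap (R := ℝ) z z'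
  have hη : ∀ t ∈ Icc (0 : ℝ) 1, η t ∈ segment ℝ z z' := by
    intro t ht
    rw [segment_eq_image_lineMap]
    exact ⟨t, ht, rfl⟩
  have hsm : ContMDiff 𝓘(ℝ, ℝ) 𝓘(ℝ, EuclideanSpace ℝ (Fin n)) 1 η :=
    contMDiff_iff_contDiff.2 (ContinuousAffineMap.contDiff _)
  have h1 : edist ((extChartAt (𝓡 n) p).symm z) ((extChartAt (𝓡 n) p).symm z')
      ≤ Manifold.pathELength (𝓡 n) ((extChartAt (𝓡 n) p).symm ∘ η) 0 1 := by
    rw [IsRiemannianManifold.out (I := 𝓡 n)]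
    refine Manifold.riemannianEDist_le_pathELength ?_ ?_ ?_ zero_le_one
    · exact (contMDiffOn_extChartAt_symm p).comp hsm.contMDiffOn fun t ht => hseg (hη t ht)
    · simp [η, ContinuousAffineMap.coe_lineMap_eq]
    · simp [η, ContinuousAffineMap.coe_lineMap_eq]
  have h2 : Manifold.pathELength (𝓡 n) ((extChartAt (𝓡 n) p).symm ∘ η) 0 1
      ≤ ∫⁻ t in Icc (0 : ℝ) 1, ENNReal.ofReal b := by
    rw [Manifold.pathELength_eq_lintegral_mfderiv_Icc]
    refine setLIntegral_mono' measurableSet_Icc fun t ht => ?_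
    have h3 : mfderiv 𝓘(ℝ, ℝ) (𝓡 n) ((extChartAt (𝓡 n) p).symm ∘ η) t (1 : ℝ)
        = coordField p (z' - z) ((extChartAt (𝓡 n) p).symm (η t)) := by
      rw [mfderiv_comp t (mdifferentiableAt_extChartAt_symm (hseg (hη t ht)))
        (hsm.mdifferentiable one_ne_zero t)]
      refine Eq.trans ?_ (mfderiv_extChartAt_symm (hseg (hη t ht)) _)
      have h4 : mfderiv 𝓘(ℝ, ℝ) 𝓘(ℝ, EuclideanSpace ℝ (Fin n)) η t (1 : ℝ) = z' - z := by
        have h5 : HasDerivAt η (z' - z) t := AffineMap.hasDerivAt_lineMap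
        rw [mfderiv_eq_fderiv]
        exact h5.deriv
      exact congrArg _ h4
    refine (congrArg (fun w : TangentSpace (𝓡 n) ((extChartAt (𝓡 n) p).symm (η t)) => ‖w‖ₑ)
      h3).le.trans ?_
    rw [← ofReal_norm]
    refine ENNReal.ofReal_le_ofReal ?_
    have h5 := h _ (hη t ht)
    rw [coordMetric_self] at h5
    exact abs_le_of_sq_le_sq' h5 hb |>.2
  have h6 := h1.trans h2
  rw [edist_dist] at h6
  simp only [lintegral_const, MeasurableSet.univ, Measure.restrict_apply, univ_inter,
    Real.volume_Icc, sub_zero, ENNReal.ofReal_one, mul_one] at h6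
  exact (ENNReal.ofReal_le_ofReal_iff hb).1 h6

end Distance

/-! ### Curves in a metric space parametrized by coordinates -/

section FirstVariation
variable {E : Type*} [NormedAddCommGroup E] [NormedSpace ℝ E] [FiniteDimensional ℝ E]
  {X : Type*} [MetricSpace X]

omit [FiniteDimensional ℝ E] in
/-- If the distance between nearby points is to first order at most the norm of the difference for
the bilinear form `G`, then the slope of a curve is at most its speed for `G`. -/
lemma le_sqrt_of_hasDerivAt {Ψ : E → X} {g : E →L[ℝ] E →L[ℝ] ℝ} {Y : ℝ → E} {v : E} {s d : ℝ}
    (hup : ∀ ε > 0, ∀ᶠ z in 𝓝 (Y s),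
      dist (Ψ (Y s)) (Ψ z) ≤ √(g (z - Y s) (z - Y s)) + ε * ‖z - Y s‖)
    (hY : HasDerivAt Y v s) {D : ℝ → ℝ} (hD : HasDerivAt D d s)
    (hDY : ∀ᶠ t in 𝓝[>] s, D t - D s ≤ dist (Ψ (Y s)) (Ψ (Y t))) :
    d ≤ √(g v v) := by
  have key : ∀ ε > 0, d ≤ √(g v v) + ε * ‖v‖ := by
    intro ε hε
    have h1 : Tendsto (fun t => (t - s)⁻¹ * (D t - D s)) (𝓝[>] s) (𝓝 d) := by
      have := hasDerivAt_iff_tendsto_slope.1 hD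
      exact this.mono_left (nhdsWithin_mono _ fun t ht => ne_of_gt ht)
    have h2 : Tendsto (fun t => (t - s)⁻¹ • (Y t - Y s)) (𝓝[>] s) (𝓝 v) := by
      have := hasDerivAt_iff_tendsto_slope.1 hY
      exact this.mono_left (nhdsWithin_mono _ fun t ht => ne_of_gt ht)
    have h3 : Tendsto (fun t => √(g ((t - s)⁻¹ • (Y t - Y s)) ((t - s)⁻¹ • (Y t - Y s)))
        + ε * ‖(t - s)⁻¹ • (Y t - Y s)‖) (𝓝[>] s) (𝓝 (√(g v v) + ε * ‖v‖)) := by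
      have hc : Continuous fun w => √(g w w) + ε * ‖w‖ := by fun_prop
      exact (hc.tendsto v).comp h2
    refine le_of_tendsto_of_tendsto h1 h3 ?_
    have h4 : ∀ᶠ t in 𝓝[>] s,
        dist (Ψ (Y s)) (Ψ (Y t)) ≤ √(g (Y t - Y s) (Y t - Y s)) + ε * ‖Y t - Y s‖ :=
      nhdsWithin_le_nhds (hY.continuousAt.eventually (hup ε hε))
    filter_upwards [h4, hDY, self_mem_nhdsWithin] with t ht4 htD hts
    have hpos : 0 < (t - s)⁻¹ := inv_pos.2 (sub_pos.2 hts)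
    calc (t - s)⁻¹ * (D t - D s)
        ≤ (t - s)⁻¹ * (√(g (Y t - Y s) (Y t - Y s)) + ε * ‖Y t - Y s‖) := by gcongr; linarith
      _ = _ := by
        rw [norm_smul, Real.norm_of_nonneg hpos.le, map_smul, map_smul,
          smul_apply, smul_eq_mul, smul_eq_mul, ← mul_assoc,
          Real.sqrt_mul (by positivity), Real.sqrt_mul_self hpos.le]
        ring
  have hlim : Tendsto (fun ε => √(g v v) + ε * ‖v‖) (𝓝[>] (0 : ℝ)) (𝓝 (√(g v v) + 0 * ‖v‖)) :=
    (tendsto_const_nhds.add (tendsto_id.mul_const _)).mono_left nhdsWithin_le_nhds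
  rw [zero_mul, add_zero] at hlim
  refine ge_of_tendsto hlim ?_
  filter_upwards [self_mem_nhdsWithin] with ε hε using key ε hε

/-- Rademacher's theorem on an interval, with the bound on the derivative. -/
lemma ae_hasDerivAt_of_lipschitzOnWith {K : ℝ≥0} {Y : ℝ → E} {a b : ℝ}
    (hY : LipschitzOnWith K Y (Icc a b)) :
    ∀ᵐ s ∂volume.restrict (Ioo a b), HasDerivAt Y (deriv Y s) s ∧ ‖deriv Y s‖ ≤ K := by
  have h1 : ∀ᵐ s ∂volume.restrict (Ioo a b), DifferentiableWithinAt ℝ Y (Ioo a b) s :=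
    (hY.mono Ioo_subset_Icc_self).ae_differentiableWithinAt_real measurableSet_Ioo
  filter_upwards [h1, ae_restrict_mem measurableSet_Ioo] with s hs hs'
  refine ⟨(hs.differentiableAt (Ioo_mem_nhds hs'.1 hs'.2)).hasDerivAt, ?_⟩
  exact norm_deriv_le_of_lipschitzOn (Icc_mem_nhds hs'.1 hs'.2) hY

/-- The distance between the end points of a Lipschitz curve is at most its length. -/
lemma dist_le_integral_speed {Ψ : E → X} {G : E → E →L[ℝ] E →L[ℝ] ℝ} {B : Set E} {C K : ℝ≥0}
    (hup : ∀ z ∈ B, ∀ ε > 0, ∀ᶠ z' in 𝓝 z,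
      dist (Ψ z) (Ψ z') ≤ √(G z (z' - z) (z' - z)) + ε * ‖z' - z‖)
    (hlip : LipschitzOnWith C Ψ B) {Y : ℝ → E} {a b : ℝ} (hab : a ≤ b)
    (hY : LipschitzOnWith K Y (Icc a b)) (hYB : MapsTo Y (Icc a b) B) {k : ℝ → ℝ}
    (hk : IntegrableOn k (Ioo a b))
    (hkY : ∀ᵐ s ∂volume.restrict (Ioo a b), √(G (Y s) (deriv Y s) (deriv Y s)) ≤ k s) :
    dist (Ψ (Y a)) (Ψ (Y b)) ≤ ∫ s in Ioo a b, k s := by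
  set D : ℝ → ℝ := fun s => dist (Ψ (Y a)) (Ψ (Y s)) with hDdef
  have hD : LipschitzOnWith (1 * (C * K)) D (Icc a b) :=
    (LipschitzWith.dist_right (Ψ (Y a))).comp_lipschitzOnWith (hlip.comp hY hYB)
  have hac : AbsolutelyContinuousOnInterval D a b :=
    LipschitzOnWith.absolutelyContinuousOnInterval (by rwa [uIcc_of_le hab])
  have hFTC := hac.integral_deriv_eq_sub
  have hDa : D a = 0 := by simp [hDdef]
  rw [hDa, sub_zero, intervalIntegral.integral_of_le hab, integral_Ioc_eq_integral_Ioo] at hFTC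
  have hint : IntegrableOn (deriv D) (Ioo a b) := by
    have := hac.intervalIntegrable_deriv
    rw [intervalIntegrable_iff_integrableOn_Ioo_of_le hab] at this
    exact this
  change D b ≤ _
  rw [← hFTC]
  refine integral_mono_ae hint hk ?_
  filter_upwards [hkY, ae_hasDerivAt_of_lipschitzOnWith hY, ae_hasDerivAt_of_lipschitzOnWith hD,
    ae_restrict_mem measurableSet_Ioo] with s hs hYs hDs hsI
  refine (le_sqrt_of_hasDerivAt (hup _ (hYB (Ioo_subset_Icc_self hsI))) hYs.1 hDs.1 ?_).trans hs
  refine Eventually.of_forall fun t => ?_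
  have := dist_triangle (Ψ (Y a)) (Ψ (Y s)) (Ψ (Y t))
  simp only [hDdef]
  linarith

end FirstVariation

/-! ### The first variation of energy in a chart -/

section FirstVariation
variable {E : Type*} [NormedAddCommGroup E] [NormedSpace ℝ E] [FiniteDimensional ℝ E]
  {X : Type*} [MetricSpace X]

set_option synthInstance.maxHeartbeats 200000 in
omit [FiniteDimensional ℝ E] in
lemma aestronglyMeasurable_clm_apply_apply {A : ℝ → E →L[ℝ] E →L[ℝ] ℝ} {v w : ℝ → E}
    {μ : Measure ℝ} (hA : AEStronglyMeasurable A μ) (hv : AEStronglyMeasurable v μ)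
    (hw : AEStronglyMeasurable w μ) : AEStronglyMeasurable (fun s => A s (v s) (w s)) μ := by
  have h : Continuous fun x : (E →L[ℝ] E →L[ℝ] ℝ) × E × E => x.1 x.2.1 x.2.2 := by fun_prop
  exact h.comp_aestronglyMeasurable (hA.prodMk (hv.prodMk hw))

set_option synthInstance.maxHeartbeats 200000 in
omit [FiniteDimensional ℝ E] in
lemma abs_bilin_sub_le {A A' : E →L[ℝ] E →L[ℝ] ℝ} {u u' : E} {CA R : ℝ}
    (hA : ‖A'‖ ≤ CA) (hu : ‖u‖ ≤ R) (hu' : ‖u'‖ ≤ R) :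
    |A u u - A' u' u'| ≤ ‖A - A'‖ * R ^ 2 + 2 * (CA * R * ‖u - u'‖) := by
  have hR : 0 ≤ R := (norm_nonneg _).trans hu
  have hCA : 0 ≤ CA := (norm_nonneg A').trans hA
  have e : A u u - A' u' u' = (A - A') u u + (A' (u - u') u + A' u' (u - u')) := by
    simp only [map_sub, sub_apply]
    ring
  have h1 : |(A - A') u u| ≤ ‖A - A'‖ * R ^ 2 := by
    refine ((A - A').le_opNorm₂ u u).trans ?_
    rw [pow_two, mul_assoc]
    gcongr
  have h2 : |A' (u - u') u| ≤ CA * R * ‖u - u'‖ := by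
    refine (A'.le_opNorm₂ (u - u') u).trans ?_
    calc ‖A'‖ * ‖u - u'‖ * ‖u‖ ≤ CA * ‖u - u'‖ * R := by gcongr
      _ = _ := by ring
  have h3 : |A' u' (u - u')| ≤ CA * R * ‖u - u'‖ := by
    refine (A'.le_opNorm₂ u' (u - u')).trans ?_
    gcongr
  rw [e]
  calc |(A - A') u u + (A' (u - u') u + A' u' (u - u'))|
      ≤ |(A - A') u u| + (|A' (u - u') u| + |A' u' (u - u')|) :=
        (abs_add_le _ _).trans (by gcongr; exact abs_add_le _ _)
    _ ≤ _ := by linarith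

omit [FiniteDimensional ℝ E] in
lemma hasDerivAt_comp_line {W : Type*} [NormedAddCommGroup W] [NormedSpace ℝ W] {G : E → W} {z : E}
    (hG : DifferentiableAt ℝ G z) (y : E) :
    HasDerivAt (fun ε : ℝ => G (z + ε • y)) (fderiv ℝ G z y) 0 := by
  have h1 : HasDerivAt (fun ε : ℝ => z + ε • y) y 0 := by
    have := ((hasDerivAt_id (0 : ℝ)).smul_const y).const_add z
    simpa using this
  have h4 : HasFDerivAt G (fderiv ℝ G z) (z + (0 : ℝ) • y) := by
    rw [zero_smul, add_zero]; exact hG.hasFDerivAt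
  exact h4.comp_hasDerivAt (0 : ℝ) h1

set_option synthInstance.maxHeartbeats 200000 in
omit [FiniteDimensional ℝ E] in
lemma hasDerivAt_bilin_line {G : E → E →L[ℝ] E →L[ℝ] ℝ} {z : E}
    (hsymm : ∀ v w, G z v w = G z w v) (hG : DifferentiableAt ℝ G z) (y v w : E) :
    HasDerivAt (fun ε : ℝ => G (z + ε • y) (v + ε • w) (v + ε • w))
      (fderiv ℝ G z y v v + 2 * G z w v) 0 := by
  have h2 : HasDerivAt (fun ε : ℝ => v + ε • w) w 0 := by
    have := ((hasDerivAt_id (0 : ℝ)).smul_const w).const_add v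
    simpa using this
  have h3 : HasDerivAt (fun ε : ℝ => G (z + ε • y)) (fderiv ℝ G z y) 0 :=
    hasDerivAt_comp_line (W := E →L[ℝ] E →L[ℝ] ℝ) hG y
  refine ((h3.clm_apply h2).clm_apply h2).congr_deriv ?_
  simp only [zero_smul, add_zero, add_apply]
  rw [hsymm v w]
  ring

set_option synthInstance.maxHeartbeats 200000 in
set_option maxHeartbeats 1600000 in
/-- First variation of the energy: if the curve `c` realizes the distance of its end points and is
parametrized by arc length, then the energy is stationary along the variation `c + ε ψ V(c)`, for
every function `ψ` that vanishes at the ends. The bilinear form `G` is related to the distance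
through `hup` only; the length of a varied curve is at most `∫ (1 + G(Y', Y')) / 2`, which is
minimal at `ε = 0`. -/
theorem first_variation {Ψ : E → X} {G : E → E →L[ℝ] E →L[ℝ] ℝ} {V : E → E} {z₀ : E} {ρ CG CV : ℝ}
    {C LG LV K L : ℝ≥0}
    (hup : ∀ z ∈ Metric.ball z₀ ρ, ∀ ε > 0, ∀ᶠ z' in 𝓝 z,
      dist (Ψ z) (Ψ z') ≤ √(G z (z' - z) (z' - z)) + ε * ‖z' - z‖)
    (hlip : LipschitzOnWith C Ψ (Metric.ball z₀ ρ))
    (hsymm : ∀ z v w, G z v w = G z w v) (hpos : ∀ z v, 0 ≤ G z v v)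
    (hGL : LipschitzOnWith LG G (Metric.ball z₀ ρ))
    (hGd : ∀ z ∈ Metric.ball z₀ ρ, DifferentiableAt ℝ G z)
    (hGb : ∀ z ∈ Metric.ball z₀ ρ, ‖G z‖ ≤ CG)
    (hVL : LipschitzOnWith LV V (Metric.ball z₀ ρ))
    (hVd : ∀ z ∈ Metric.ball z₀ ρ, DifferentiableAt ℝ V z)
    (hVc : ContinuousOn (fderiv ℝ V) (Metric.ball z₀ ρ))
    (hVb : ∀ z ∈ Metric.ball z₀ ρ, ‖V z‖ ≤ CV)
    {c : ℝ → E} {ψ : ℝ → ℝ} {a b : ℝ} (hab : a ≤ b)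
    (hc : LipschitzOnWith K c (Icc a b)) (hψ : LipschitzOnWith L ψ (Icc a b))
    (hcB : MapsTo c (Icc a b) (Metric.ball z₀ (ρ / 2))) (hψa : ψ a = 0) (hψb : ψ b = 0)
    (hmin : dist (Ψ (c a)) (Ψ (c b)) = b - a)
    (hunit : ∀ᵐ s ∂volume.restrict (Ioo a b), G (c s) (deriv c s) (deriv c s) ≤ 1) :
    ∫ s in Ioo a b,
      (ψ s * (fderiv ℝ G (c s) (V (c s)) (deriv c s) (deriv c s)
          + 2 * G (c s) (fderiv ℝ V (c s) (deriv c s)) (deriv c s))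
        + 2 * deriv ψ s * G (c s) (V (c s)) (deriv c s)) = 0 := by
  set B := Metric.ball z₀ ρ with hB
  set μ := volume.restrict (Ioo a b) with hμ
  have hBo : IsOpen B := Metric.isOpen_ball
  have hρ : 0 < ρ := by
    have := hcB (left_mem_Icc.2 hab)
    rw [Metric.mem_ball] at this
    linarith [dist_nonneg.trans_lt this]
  have hcB' : MapsTo c (Icc a b) B := fun s hs =>
    Metric.ball_subset_ball (by linarith) (hcB hs)
  have hCG : 0 ≤ CG := (norm_nonneg (G (c a))).trans (hGb _ (hcB' (left_mem_Icc.2 hab)))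
  have hCV : 0 ≤ CV := (norm_nonneg _).trans (hVb _ (hcB' (left_mem_Icc.2 hab)))
  -- bounds for the test function
  obtain ⟨Cψ, hCψ0, hCψ⟩ : ∃ Cψ : ℝ, 0 ≤ Cψ ∧ ∀ s ∈ Icc a b, |ψ s| ≤ Cψ := by
    obtain ⟨Cψ, h⟩ := isCompact_Icc.exists_bound_of_continuousOn hψ.continuousOn
    exact ⟨Cψ, (norm_nonneg _).trans (h a (left_mem_Icc.2 hab)), h⟩
  obtain ⟨ε₀, hε₀, hε₁, hε₀'⟩ : ∃ ε₀ > 0, ε₀ ≤ 1 ∧ ε₀ * (Cψ * CV) < ρ / 2 := by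
    have h : Tendsto (fun ε : ℝ => ε * (Cψ * CV)) (𝓝[>] 0) (𝓝 (0 * (Cψ * CV))) :=
      (tendsto_id.mul_const _).mono_left nhdsWithin_le_nhds
    rw [zero_mul] at h
    have h1 : ∀ᶠ ε : ℝ in 𝓝[>] 0, ε ≤ 1 := nhdsWithin_le_nhds (Iic_mem_nhds one_pos)
    obtain ⟨ε, h2, h3, h4⟩ := ((h.eventually (Iio_mem_nhds (half_pos hρ))).and
      (h1.and self_mem_nhdsWithin)).exists
    exact ⟨ε, h4, h3, h2⟩
  -- the variation, its velocity and its energy density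
  set Y : ℝ → ℝ → E := fun ε s => c s + ε • (ψ s • V (c s)) with hY
  set w : ℝ → E := fun s => ψ s • fderiv ℝ V (c s) (deriv c s) + deriv ψ s • V (c s) with hw
  set F : ℝ → ℝ → ℝ := fun ε s => G (Y ε s) (deriv c s + ε • w s) (deriv c s + ε • w s) with hF
  set F' : ℝ → ℝ := fun s =>
    ψ s * (fderiv ℝ G (c s) (V (c s)) (deriv c s) (deriv c s)
          + 2 * G (c s) (fderiv ℝ V (c s) (deriv c s)) (deriv c s))
        + 2 * deriv ψ s * G (c s) (V (c s)) (deriv c s) with hF'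
  have hIoo : Ioo a b ⊆ Icc a b := Ioo_subset_Icc_self
  have hYB : ∀ ε ∈ Metric.ball (0 : ℝ) ε₀, MapsTo (Y ε) (Icc a b) B := by
    intro ε hε s hs
    rw [mem_ball_zero_iff, Real.norm_eq_abs] at hε
    have h1 : ‖ε • (ψ s • V (c s))‖ ≤ ε₀ * (Cψ * CV) := by
      rw [norm_smul, norm_smul, Real.norm_eq_abs, Real.norm_eq_abs]
      gcongr
      · exact hCψ s hs
      · exact hVb _ (hcB' hs)
    have h2 : dist (c s) z₀ < ρ / 2 := hcB hs
    rw [hB, Metric.mem_ball]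
    calc dist (Y ε s) z₀ ≤ dist (Y ε s) (c s) + dist (c s) z₀ := dist_triangle _ _ _
      _ < ρ := by
        have : dist (Y ε s) (c s) = ‖ε • (ψ s • V (c s))‖ := by simp [hY, dist_eq_norm]
        linarith
  have hVcL : LipschitzOnWith (LV * K) (V ∘ c) (Icc a b) := hVL.comp hc hcB'
  have hYL : ∀ ε, ∃ KY : ℝ≥0, LipschitzOnWith KY (Y ε) (Icc a b) := by
    intro ε
    have h1 : LipschitzOnWith (‖ε‖₊ * (Cψ.toNNReal * (LV * K) + L * CV.toNNReal))
        (fun s => ε • (ψ s • V (c s))) (Icc a b) := by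
      refine LipschitzOnWith.of_dist_le_mul fun s hs t ht => ?_
      have e : ε • (ψ s • V (c s)) - ε • (ψ t • V (c t))
          = ε • (ψ s • (V (c s) - V (c t)) + (ψ s - ψ t) • V (c t)) := by
        simp only [smul_sub, sub_smul, smul_add]
        abel
      rw [dist_eq_norm, e, norm_smul]
      push_cast
      rw [Real.coe_toNNReal _ hCψ0, Real.coe_toNNReal _ hCV, mul_assoc]
      refine mul_le_mul_of_nonneg_left ?_ (norm_nonneg _)
      refine (norm_add_le _ _).trans ?_
      rw [norm_smul, norm_smul]
      have h3 : ‖V (c s) - V (c t)‖ ≤ LV * K * dist s t := by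
        rw [← dist_eq_norm]
        simpa using hVcL.dist_le_mul s hs t ht
      have h4 : ‖ψ s - ψ t‖ ≤ L * dist s t := by
        rw [← dist_eq_norm]
        exact hψ.dist_le_mul s hs t ht
      calc ‖ψ s‖ * ‖V (c s) - V (c t)‖ + ‖ψ s - ψ t‖ * ‖V (c t)‖
          ≤ Cψ * (LV * K * dist s t) + L * dist s t * CV := by
            gcongr
            · exact hCψ s hs
            · exact hVb _ (hcB' ht)
        _ = _ := by ring
    exact ⟨_, hc.add h1⟩
  have hae := ae_hasDerivAt_of_lipschitzOnWith hc
  have haeψ := ae_hasDerivAt_of_lipschitzOnWith hψ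
  have haeI : ∀ᵐ s ∂μ, s ∈ Ioo a b := ae_restrict_mem measurableSet_Ioo
  have hYd : ∀ᵐ s ∂μ, ∀ ε, HasDerivAt (Y ε) (deriv c s + ε • w s) s := by
    filter_upwards [hae, haeψ, haeI] with s hs hψs hsI ε
    have h1 : HasDerivAt (fun t => V (c t)) (fderiv ℝ V (c s) (deriv c s)) s :=
      (hVd _ (hcB' (hIoo hsI))).hasFDerivAt.comp_hasDerivAt s hs.1
    have h2 : HasDerivAt (Y ε) _ s := hs.1.add ((hψs.1.smul h1).const_smul ε)
    exact h2
  -- a common bound for the velocities of the varied curves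
  set R : ℝ := K + (Cψ * (LV * K) + L * CV) with hR
  have hwb : ∀ᵐ s ∂μ, ‖w s‖ ≤ Cψ * (LV * K) + L * CV := by
    filter_upwards [hae, haeψ, haeI] with s hs hψs hsI
    have h1 : ‖fderiv ℝ V (c s)‖ ≤ LV :=
      norm_fderiv_le_of_lipschitzOn ℝ (hBo.mem_nhds (hcB' (hIoo hsI))) hVL
    refine (norm_add_le _ _).trans ?_
    rw [norm_smul, norm_smul]
    gcongr
    · exact hCψ s (hIoo hsI)
    · exact ((fderiv ℝ V (c s)).le_opNorm _).trans (by gcongr; exact hs.2)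
    · exact hψs.2
    · exact hVb _ (hcB' (hIoo hsI))
  have hvb : ∀ᵐ s ∂μ, ∀ ε ∈ Metric.ball (0 : ℝ) ε₀, ‖deriv c s + ε • w s‖ ≤ R := by
    filter_upwards [hae, hwb] with s hs hws ε hε
    rw [mem_ball_zero_iff] at hε
    refine (norm_add_le _ _).trans ?_
    rw [norm_smul, hR]
    refine add_le_add hs.2 ?_
    calc ‖ε‖ * ‖w s‖ ≤ 1 * ‖w s‖ := by gcongr; linarith
      _ ≤ _ := by rwa [one_mul]
  have hR0 : 0 ≤ R := by positivity
  have hcc : ContinuousOn c (Ioo a b) := hc.continuousOn.mono hIoo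
  have hmc : AEStronglyMeasurable (fun s => V (c s)) μ :=
    (hVcL.continuousOn.mono hIoo).aestronglyMeasurable measurableSet_Ioo
  have hmψ : AEStronglyMeasurable ψ μ :=
    (hψ.continuousOn.mono hIoo).aestronglyMeasurable measurableSet_Ioo
  have hmdc : AEStronglyMeasurable (deriv c) μ := (stronglyMeasurable_deriv c).aestronglyMeasurable
  have hmdψ : AEStronglyMeasurable (deriv ψ) μ := (stronglyMeasurable_deriv ψ).aestronglyMeasurable
  have hmdV : AEStronglyMeasurable (fun s => fderiv ℝ V (c s)) μ :=
    (hVc.comp hcc fun s hs => hcB' (hIoo hs)).aestronglyMeasurable measurableSet_Ioo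
  have hmw : AEStronglyMeasurable w μ := by
    have h : Continuous fun x : (E →L[ℝ] E) × E => x.1 x.2 := by fun_prop
    exact (hmψ.smul (h.comp_aestronglyMeasurable (hmdV.prodMk hmdc))).add (hmdψ.smul hmc)
  have hmF : ∀ ε ∈ Metric.ball (0 : ℝ) ε₀, AEStronglyMeasurable (F ε) μ := by
    intro ε hε
    obtain ⟨KY, hKY⟩ := hYL ε
    have h1 : AEStronglyMeasurable (fun s => G (Y ε s)) μ :=
      (hGL.continuousOn.comp (hKY.continuousOn.mono hIoo)
        fun s hs => hYB ε hε (hIoo hs)).aestronglyMeasurable measurableSet_Ioo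
    have h2 : AEStronglyMeasurable (fun s => deriv c s + ε • w s) μ := hmdc.add (hmw.const_smul ε)
    exact aestronglyMeasurable_clm_apply_apply h1 h2 h2
  have hFb : ∀ ε ∈ Metric.ball (0 : ℝ) ε₀, ∀ᵐ s ∂μ, ‖F ε s‖ ≤ CG * R * R := by
    intro ε hε
    filter_upwards [hvb, haeI] with s hs hsI
    refine ((G (Y ε s)).le_opNorm₂ _ _).trans ?_
    gcongr
    · exact hGb _ (hYB ε hε (hIoo hsI))
    · exact hs ε hε
    · exact hs ε hε
  have hFi : ∀ ε ∈ Metric.ball (0 : ℝ) ε₀, Integrable (F ε) μ := fun ε hε =>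
    Integrable.of_bound (hmF ε hε) _ (hFb ε hε)
  have h0 : (0 : ℝ) ∈ Metric.ball (0 : ℝ) ε₀ := Metric.mem_ball_self hε₀
  -- differentiability of the energy
  have hderiv : ∀ᵐ s ∂μ, HasDerivAt (fun ε => F ε s) (F' s) 0 := by
    filter_upwards [haeI] with s hsI
    refine (hasDerivAt_bilin_line (fun v w => hsymm _ v w) (hGd _ (hcB' (hIoo hsI)))
      (ψ s • V (c s)) (deriv c s) (w s)).congr_deriv ?_
    simp only [hF', hw, map_add, map_smul, smul_apply, add_apply, smul_eq_mul]
    ring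
  set bd : ℝ := LG * (Cψ * CV) * R ^ 2 + 2 * (CG * R * (Cψ * (LV * K) + L * CV)) with hbd
  have hbd0 : 0 ≤ bd := by positivity
  have hlipF : ∀ᵐ s ∂μ, LipschitzOnWith (Real.nnabs bd) (fun ε => F ε s) (Metric.ball 0 ε₀) := by
    filter_upwards [haeI, hvb, hwb] with s hsI hs hws
    refine LipschitzOnWith.of_dist_le_mul fun ε hε δ hδ => ?_
    rw [Real.coe_nnabs, abs_of_nonneg hbd0, Real.dist_eq]
    refine (abs_bilin_sub_le (hGb _ (hYB δ hδ (hIoo hsI))) (hs ε hε) (hs δ hδ)).trans ?_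
    have h1 : ‖G (Y ε s) - G (Y δ s)‖ ≤ LG * (Cψ * CV) * dist ε δ := by
      rw [← dist_eq_norm (G (Y ε s)) (G (Y δ s))]
      refine (hGL.dist_le_mul _ (hYB ε hε (hIoo hsI)) _ (hYB δ hδ (hIoo hsI))).trans ?_
      rw [mul_assoc]
      refine mul_le_mul_of_nonneg_left ?_ LG.2
      have e : Y ε s - Y δ s = (ε - δ) • (ψ s • V (c s)) := by
        simp only [hY, sub_smul]
        abel
      rw [dist_eq_norm, e, norm_smul, norm_smul, ← dist_eq_norm, mul_comm]
      gcongr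
      · exact hCψ s (hIoo hsI)
      · exact hVb _ (hcB' (hIoo hsI))
    have h2 : ‖deriv c s + ε • w s - (deriv c s + δ • w s)‖
        ≤ dist ε δ * (Cψ * (LV * K) + L * CV) := by
      rw [add_sub_add_left_eq_sub, ← sub_smul, norm_smul, ← dist_eq_norm]
      gcongr
    calc _ ≤ LG * (Cψ * CV) * dist ε δ * R ^ 2
          + 2 * (CG * R * (dist ε δ * (Cψ * (LV * K) + L * CV))) := by gcongr
      _ = _ := by rw [hbd]; ring
  have hmF' : AEStronglyMeasurable F' μ := by
    -- the derivative is the a.e. limit of difference quotients of measurable functions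
    have hlim : ∀ᵐ s ∂μ, Tendsto (fun k : ℕ => ((ε₀ / (k + 2) : ℝ))⁻¹ *
        (F (ε₀ / (k + 2)) s - F 0 s)) atTop (𝓝 (F' s)) := by
      filter_upwards [hderiv] with s hs
      have h1 := hasDerivAt_iff_tendsto_slope.1 hs
      have h2 : Tendsto (fun k : ℕ => (ε₀ / (k + 2) : ℝ)) atTop (𝓝[≠] 0) := by
        refine tendsto_nhdsWithin_iff.2 ⟨?_, Eventually.of_forall fun k => ?_⟩
        · refine Tendsto.div_atTop tendsto_const_nhds ?_
          exact tendsto_atTop_add_const_right _ _ tendsto_natCast_atTop_atTop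
        · have : (0 : ℝ) < ε₀ / (k + 2) := by positivity
          exact this.ne'
      refine (h1.comp h2).congr fun k => ?_
      simp [slope]
    refine aestronglyMeasurable_of_tendsto_ae atTop (fun k => ?_) hlim
    have hk : (ε₀ / ((k : ℝ) + 2)) ∈ Metric.ball (0 : ℝ) ε₀ := by
      rw [mem_ball_zero_iff, Real.norm_of_nonneg (by positivity)]
      refine div_lt_self hε₀ ?_
      have : (0 : ℝ) ≤ k := k.cast_nonneg
      linarith
    exact ((hmF _ hk).sub (hmF 0 h0)).const_mul _
  have hJ := (hasDerivAt_integral_of_dominated_loc_of_lip (μ := μ) (F := F) (F' := F')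
    (bound := fun _ => bd) (Metric.ball_mem_nhds (0 : ℝ) hε₀)
    (Filter.eventually_of_mem (Metric.ball_mem_nhds (0 : ℝ) hε₀) hmF) (hFi 0 h0) hmF' hlipF
    (integrable_const _) hderiv).2
  -- the energy is minimal at `ε = 0`
  have hvol : ∫ _ in Ioo a b, (1 : ℝ) = b - a := by
    simp [hab]
  have hlow : ∀ ε ∈ Metric.ball (0 : ℝ) ε₀, b - a ≤ ∫ s, F ε s ∂μ := by
    intro ε hε
    obtain ⟨KY, hKY⟩ := hYL ε
    have hi : IntegrableOn (fun s => (1 + F ε s) / 2) (Ioo a b) :=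
      ((integrable_const 1).add (hFi ε hε)).div_const 2
    have h1 := dist_le_integral_speed hup hlip hab hKY (hYB ε hε) hi (by
      filter_upwards [hYd] with s hs
      rw [(hs ε).deriv]
      have h2 := Real.sq_sqrt (hpos (Y ε s) (deriv c s + ε • w s))
      have h3 : F ε s = G (Y ε s) (deriv c s + ε • w s) (deriv c s + ε • w s) := rfl
      rw [h3]
      nlinarith [sq_nonneg (√(G (Y ε s) (deriv c s + ε • w s) (deriv c s + ε • w s)) - 1)])
    have ha : Y ε a = c a := by simp [hY, hψa]
    have hb : Y ε b = c b := by simp [hY, hψb]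
    rw [ha, hb, hmin] at h1
    have h2 : ∫ s in Ioo a b, (1 + F ε s) / 2 = ((b - a) + ∫ s, F ε s ∂μ) / 2 := by
      rw [integral_div, integral_add (integrable_const 1) (hFi ε hε), hvol]
    rw [h2] at h1
    linarith
  have hhigh : ∫ s, F 0 s ∂μ ≤ b - a := by
    rw [← hvol]
    refine integral_mono_ae (hFi 0 h0) (integrable_const 1) ?_
    filter_upwards [hunit] with s hs
    simpa [hF, hY] using hs
  have hmin' : IsLocalMin (fun ε => ∫ s, F ε s ∂μ) 0 := by
    filter_upwards [Metric.ball_mem_nhds (0 : ℝ) hε₀] with ε hε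
    exact hhigh.trans (hlow ε hε)
  exact hmin'.hasDerivAt_eq_zero hJ

end FirstVariation

/-! ### Comparison of the distance with the coordinates of a chart -/

set_option synthInstance.maxHeartbeats 200000

section Bilinear
variable {E : Type*} [NormedAddCommGroup E] [NormedSpace ℝ E]

omit [NormedSpace ℝ E] in
lemma eventually_norm_sub_lt {W : Type*} [NormedAddCommGroup W] {G : E → W} {z : E}
    (hG : ContinuousAt G z) {ε : ℝ} (hε : 0 < ε) : ∀ᶠ y in 𝓝 z, ‖G y - G z‖ < ε := by
  filter_upwards [Metric.tendsto_nhds.1 hG ε hε] with y hy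
  rwa [← dist_eq_norm]

lemma abs_bilin_sub_self_le (A A' : E →L[ℝ] E →L[ℝ] ℝ) (v : E) :
    |A v v - A' v v| ≤ ‖A - A'‖ * ‖v‖ ^ 2 := by
  have h := (A - A').le_opNorm₂ v v
  rw [pow_two, ← mul_assoc]
  simpa using h

/-- A continuous family of bilinear forms that is positive definite at `z₀` is uniformly positive
definite near `z₀`. -/
lemma exists_forall_norm_le_mul_sqrt [FiniteDimensional ℝ E] {G : E → E →L[ℝ] E →L[ℝ] ℝ} {z₀ : E}
    (hG : ContinuousAt G z₀) (hpos : ∀ v, v ≠ 0 → 0 < G z₀ v v) :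
    ∃ C > 0, ∀ᶠ z in 𝓝 z₀, ∀ v, ‖v‖ ≤ C * √(G z v v) := by
  have hc : Continuous fun v => G z₀ v v := by fun_prop
  obtain ⟨m, hm0, hm⟩ := (isCompact_sphere (0 : E) 1).exists_forall_le' hc.continuousOn
    (a := 0) fun v hv => hpos v fun h => by simp [h] at hv
  have hm' : ∀ v, m * ‖v‖ ^ 2 ≤ G z₀ v v := by
    intro v
    rcases eq_or_ne v 0 with rfl | hv
    · simp
    have hv' : ‖v‖ ≠ 0 := norm_ne_zero_iff.2 hv
    have h := hm (‖v‖⁻¹ • v) (by simp [norm_smul, hv'])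
    simp only [map_smul, smul_apply, smul_eq_mul] at h
    have h2 : G z₀ v v = ‖v‖ ^ 2 * (‖v‖⁻¹ * (‖v‖⁻¹ * G z₀ v v)) := by field_simp
    rw [h2, mul_comm]
    gcongr
  refine ⟨√(2 / m), by positivity, ?_⟩
  have h1 : ∀ᶠ z in 𝓝 z₀, ‖G z - G z₀‖ < m / 2 :=
    eventually_norm_sub_lt (W := E →L[ℝ] E →L[ℝ] ℝ) hG (half_pos hm0)
  filter_upwards [h1] with z hz v
  rw [← Real.sqrt_mul (by positivity)]
  refine Real.le_sqrt_of_sq_le ?_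
  have h2 := (abs_le.1 (abs_bilin_sub_self_le (G z) (G z₀) v)).1
  have h3 : ‖G z - G z₀‖ * ‖v‖ ^ 2 ≤ m / 2 * ‖v‖ ^ 2 := by gcongr
  have h4 : m / 2 * ‖v‖ ^ 2 ≤ G z v v := by linarith [hm' v]
  calc ‖v‖ ^ 2 = 2 / m * (m / 2 * ‖v‖ ^ 2) := by field_simp
    _ ≤ _ := by gcongr

end Bilinear

section LocalComparison
variable {n : ℕ} {M : Type*} [MetricSpace M] [ChartedSpace (EuclideanSpace ℝ (Fin n)) M]
  [IsManifold (𝓡 n) ∞ M] [RiemannianBundle (fun x : M => TangentSpace (𝓡 n) x)]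
  [IsContMDiffRiemannianBundle (𝓡 n) ∞ (EuclideanSpace ℝ (Fin n))
          (fun x : M => TangentSpace (𝓡 n) x)]

omit [IsContMDiffRiemannianBundle (𝓡 n) ∞ (EuclideanSpace ℝ (Fin n))
          (fun x : M => TangentSpace (𝓡 n) x)] in
lemma coordMetric_pos {p : M} {z : EuclideanSpace ℝ (Fin n)}
    (hz : z ∈ (extChartAt (𝓡 n) p).target) {v : EuclideanSpace ℝ (Fin n)} (hv : v ≠ 0) :
    0 < coordMetric p z v v := by
  rw [coordMetric_self]
  have : coordField p v ((extChartAt (𝓡 n) p).symm z) ≠ 0 := fun h =>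
    hv (coordField_eq_zero ((extChartAt (𝓡 n) p).map_target hz) h)
  have := norm_pos_iff.2 this
  positivity

omit [IsManifold (𝓡 n) ∞ M] [IsContMDiffRiemannianBundle (𝓡 n) ∞
    (EuclideanSpace ℝ (Fin n)) (fun x : M => TangentSpace (𝓡 n) x)] in
lemma sqrt_coordMetric (p : M) (z v : EuclideanSpace ℝ (Fin n)) :
    √(coordMetric p z v v) = ‖coordField p v ((extChartAt (𝓡 n) p).symm z)‖ := by
  rw [coordMetric_self, Real.sqrt_sq (norm_nonneg _)]

lemma continuousAt_coordMetric {p : M} {z : EuclideanSpace ℝ (Fin n)}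
    (hz : z ∈ (extChartAt (𝓡 n) p).target) : ContinuousAt (coordMetric p) z :=
  (contDiffOn_coordMetric p).continuousOn.continuousAt
    ((isOpen_extChartAt_target (I := 𝓡 n) p).mem_nhds hz)

omit [RiemannianBundle (fun x : M => TangentSpace (𝓡 n) x)] [IsContMDiffRiemannianBundle (𝓡 n) ∞
    (EuclideanSpace ℝ (Fin n)) (fun x : M => TangentSpace (𝓡 n) x)] in
lemma coordField_mvfderiv_extChartAt {p y : M} (hy : y ∈ (extChartAt (𝓡 n) p).source)
    (w : TangentSpace (𝓡 n) y) :
    coordField p (mvfderiv (𝓡 n) (extChartAt (𝓡 n) p) y w) y = w :=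
  coordField_mfderiv_extChartAt hy w

/-- Near every point, the norm of the coordinates of a tangent vector is controlled by its
Riemannian norm. -/
lemma exists_norm_mfderiv_extChartAt_le {p y : M} (hy : y ∈ (extChartAt (𝓡 n) p).source) :
    ∃ C > 0, ∀ᶠ y' in 𝓝 y, ∀ w : TangentSpace (𝓡 n) y',
      ‖mvfderiv (𝓡 n) (extChartAt (𝓡 n) p) y' w‖ ≤ C * ‖w‖ := by
  have hz := (extChartAt (𝓡 n) p).map_source hy
  obtain ⟨C, hC0, hC⟩ := exists_forall_norm_le_mul_sqrt (continuousAt_coordMetric hz)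
    fun v hv => coordMetric_pos hz hv
  refine ⟨C, hC0, ?_⟩
  filter_upwards [(continuousAt_extChartAt' hy).eventually hC,
    (isOpen_extChartAt_source (I := 𝓡 n) p).mem_nhds hy] with y' h1 h2 w
  have h3 := h1 (mvfderiv (𝓡 n) (extChartAt (𝓡 n) p) y' w)
  rw [sqrt_coordMetric, (extChartAt (𝓡 n) p).left_inv h2, coordField_mvfderiv_extChartAt h2] at h3
  exact h3

variable [IsRiemannianManifold (𝓡 n) M]

/-- The charts are locally Lipschitz for the Riemannian distance. -/
lemma exists_lipschitzOnWith_extChartAt {p y : M} (hy : y ∈ (extChartAt (𝓡 n) p).source) :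
    ∃ K : ℝ≥0, ∃ r > 0, LipschitzOnWith K (extChartAt (𝓡 n) p) (Metric.ball y r) := by
  obtain ⟨C, hC0, hC⟩ := exists_norm_mfderiv_extChartAt_le (n := n) hy
  obtain ⟨r, hr0, hr⟩ := Metric.eventually_nhds_iff_ball.1
    (hC.and ((isOpen_extChartAt_source (I := 𝓡 n) p).mem_nhds hy))
  refine ⟨C.toNNReal, r / 3, by positivity, LipschitzOnWith.of_dist_le_mul fun y₁ h₁ y₂ h₂ => ?_⟩
  rw [Real.coe_toNNReal _ hC0.le, dist_comm, dist_eq_norm]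
  refine norm_sub_le_mul_dist (n := n) (x := y) (r := r) hC0.le (fun y' hy' => ?_)
    (fun y' hy' w => (hr y' hy').1 w) ?_
  · have h1 : y' ∈ (extChartAt (𝓡 n) p).source := (hr y' hy').2
    exact contMDiffAt_extChartAt' (by simpa using h1)
  · have := dist_triangle_right y₁ y₂ y
    rw [Metric.mem_ball] at h₁ h₂
    linarith

/-- The distance is to first order at most the Riemannian norm of the coordinate difference. -/
lemma eventually_dist_extChartAt_symm_le {p : M} {z : EuclideanSpace ℝ (Fin n)}
    (hz : z ∈ (extChartAt (𝓡 n) p).target) {ε : ℝ} (hε : 0 < ε) :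
    ∀ᶠ z' in 𝓝 z, dist ((extChartAt (𝓡 n) p).symm z) ((extChartAt (𝓡 n) p).symm z')
      ≤ √(coordMetric p z (z' - z) (z' - z)) + ε * ‖z' - z‖ := by
  have h1 : ∀ᶠ y in 𝓝 z, ‖coordMetric p y - coordMetric p z‖ < ε ^ 2 :=
    eventually_norm_sub_lt
      (W := EuclideanSpace ℝ (Fin n) →L[ℝ] EuclideanSpace ℝ (Fin n) →L[ℝ] ℝ)
      (continuousAt_coordMetric hz) (by positivity)
  obtain ⟨r, hr0, hr⟩ := Metric.eventually_nhds_iff_ball.1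
    (h1.and ((isOpen_extChartAt_target (I := 𝓡 n) p).mem_nhds hz))
  filter_upwards [Metric.ball_mem_nhds z hr0] with z' hz'
  have hseg : segment ℝ z z' ⊆ Metric.ball z r :=
    (convex_ball z r).segment_subset (Metric.mem_ball_self hr0) hz'
  refine dist_extChartAt_symm_le (by positivity) (fun y hy => (hr y (hseg hy)).2) fun y hy => ?_
  have h2 := (hr y (hseg hy)).1
  have h3 := (abs_le.1 (abs_bilin_sub_self_le (coordMetric p y) (coordMetric p z) (z' - z))).2
  have h4 : ‖coordMetric p y - coordMetric p z‖ * ‖z' - z‖ ^ 2 ≤ ε ^ 2 * ‖z' - z‖ ^ 2 := by gcongr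
  have h5 : 0 ≤ coordMetric p z (z' - z) (z' - z) := by rw [coordMetric_self]; positivity
  have h6 := Real.sq_sqrt h5
  have h7 : 0 ≤ √(coordMetric p z (z' - z) (z' - z)) * (ε * ‖z' - z‖) := by positivity
  nlinarith

/-- A function whose differential at `y` has norm at most `c` is to first order `c`-Lipschitz
at `y`. -/
lemma eventually_abs_sub_le {u : M → ℝ} {y : M}
    (hu : ∀ᶠ y' in 𝓝 y, ContMDiffAt (𝓡 n) 𝓘(ℝ, ℝ) 1 u y') {c : ℝ} (hc : 0 ≤ c)
    (h : ∀ w : TangentSpace (𝓡 n) y, |mvfderiv (𝓡 n) u y w| ≤ c * ‖w‖) {ε : ℝ} (hε : 0 < ε) :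
    ∀ᶠ y' in 𝓝 y, |u y' - u y| ≤ (c + ε) * dist y y' := by
  have hy := mem_extChartAt_source (I := 𝓡 n) y
  set φ := extChartAt (𝓡 n) y with hφ
  have hz := φ.map_source hy
  have htn := (isOpen_extChartAt_target (I := 𝓡 n) y).mem_nhds hz
  have hyu := hu.self_of_nhds
  obtain ⟨C, hC0, hC⟩ := exists_forall_norm_le_mul_sqrt (continuousAt_coordMetric hz)
    fun v hv => coordMetric_pos hz hv
  -- the size of the perturbation that is allowed
  obtain ⟨δ, hδ0, hδ⟩ : ∃ δ > 0, c * (δ * C) + δ * C < ε := by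
    have ht : Tendsto (fun δ : ℝ => c * (δ * C) + δ * C) (𝓝[>] 0) (𝓝 (c * (0 * C) + 0 * C)) :=
      Tendsto.mono_left (Continuous.tendsto (by fun_prop) 0) nhdsWithin_le_nhds
    simp only [zero_mul, mul_zero, add_zero] at ht
    obtain ⟨δ, h1, h2⟩ := ((ht.eventually (Iio_mem_nhds hε)).and self_mem_nhdsWithin).exists
    exact ⟨δ, h2, h1⟩
  have hud : ContDiffAt ℝ 1 (u ∘ φ.symm) (φ y) := by
    have h1 : ContMDiffAt (𝓡 n) 𝓘(ℝ, ℝ) 1 u (φ.symm (φ y)) := by rwa [φ.left_inv hy]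
    exact (h1.comp (φ y) ((contMDiffOn_extChartAt_symm (n := 1) y).contMDiffAt htn)).contDiffAt
  have hcont : ContinuousAt (fderiv ℝ (u ∘ φ.symm)) (φ y) :=
    (hud.fderiv_right (m := 0) (by simp)).continuousAt
  have h1 : ∀ᶠ z in 𝓝 (φ y), dist (fderiv ℝ (u ∘ φ.symm) z) (fderiv ℝ (u ∘ φ.symm) (φ y)) < δ :=
    Metric.tendsto_nhds.1 hcont _ hδ0
  have h2 : ∀ᶠ z in 𝓝 (φ y), ‖coordMetric y z - coordMetric y (φ y)‖ < δ ^ 2 :=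
    eventually_norm_sub_lt
      (W := EuclideanSpace ℝ (Fin n) →L[ℝ] EuclideanSpace ℝ (Fin n) →L[ℝ] ℝ)
      (continuousAt_coordMetric hz) (by positivity)
  have h0 : ∀ v, |fderiv ℝ (u ∘ φ.symm) (φ y) v| ≤ c * √(coordMetric y (φ y) v v) := by
    intro v
    rw [sqrt_coordMetric]
    have hd : MDifferentiableAt (𝓡 n) 𝓘(ℝ, ℝ) u (φ.symm (φ y)) := by
      rw [φ.left_inv hy]; exact hyu.mdifferentiableAt one_ne_zero
    rw [fderiv_comp_extChartAt_symm hz hd, φ.left_inv hy]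
    exact h _
  have h3 : ∀ᶠ z in 𝓝 (φ y), ∀ v,
      |fderiv ℝ (u ∘ φ.symm) z v| ≤ (c + ε) * √(coordMetric y z v v) := by
    filter_upwards [h1, h2, hC] with z hz1 hz2 hzC v
    have hN := hzC v
    set N := √(coordMetric y z v v) with hNdef
    have hN0 : 0 ≤ N := Real.sqrt_nonneg _
    have e1 : |fderiv ℝ (u ∘ φ.symm) z v| ≤ |fderiv ℝ (u ∘ φ.symm) (φ y) v| + δ * ‖v‖ := by
      have h4 := (fderiv ℝ (u ∘ φ.symm) z - fderiv ℝ (u ∘ φ.symm) (φ y)).le_opNorm v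
      rw [← dist_eq_norm, sub_apply, Real.norm_eq_abs] at h4
      have h5 : dist (fderiv ℝ (u ∘ φ.symm) z) (fderiv ℝ (u ∘ φ.symm) (φ y)) * ‖v‖ ≤ δ * ‖v‖ := by
        gcongr
      have h6 := abs_sub_abs_le_abs_sub (fderiv ℝ (u ∘ φ.symm) z v)
        (fderiv ℝ (u ∘ φ.symm) (φ y) v)
      linarith
    have e2 : √(coordMetric y (φ y) v v) ≤ N + δ * ‖v‖ := by
      refine Real.sqrt_le_iff.2 ⟨by positivity, ?_⟩
      have h4 := (abs_le.1 (abs_bilin_sub_self_le (coordMetric y z) (coordMetric y (φ y)) v)).1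
      have h5 : ‖coordMetric y z - coordMetric y (φ y)‖ * ‖v‖ ^ 2 ≤ δ ^ 2 * ‖v‖ ^ 2 := by
        gcongr
      have h6 : N ^ 2 = coordMetric y z v v := Real.sq_sqrt (by rw [coordMetric_self]; positivity)
      have h7 : 0 ≤ N * (δ * ‖v‖) := by positivity
      nlinarith
    have e3 : δ * ‖v‖ ≤ δ * C * N := by rw [mul_assoc]; gcongr
    calc |fderiv ℝ (u ∘ φ.symm) z v| ≤ c * (N + δ * C * N) + δ * C * N := by
          have := mul_le_mul_of_nonneg_left (e2.trans (add_le_add_right e3 N)) hc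
          linarith [h0 v]
      _ = (c + (c * (δ * C) + δ * C)) * N := by ring
      _ ≤ (c + ε) * N := by gcongr
  obtain ⟨r, hr0, hr⟩ := Metric.eventually_nhds_iff_ball.1
    (((continuousAt_extChartAt' hy).eventually h3).and (hu.and
      ((isOpen_extChartAt_source (I := 𝓡 n) y).mem_nhds hy)))
  filter_upwards [Metric.ball_mem_nhds y hr0] with y' hy'
  rw [← Real.norm_eq_abs]
  refine norm_sub_le_mul_dist (n := n) (x := y) (r := r) (by positivity)
    (fun y'' hy'' => (hr y'' hy'').2.1) (fun y'' hy'' w => ?_) ?_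
  · obtain ⟨h4, h5, h6⟩ := hr y'' hy''
    have h7 := h4 (mvfderiv (𝓡 n) φ y'' w)
    have hd : MDifferentiableAt (𝓡 n) 𝓘(ℝ, ℝ) u (φ.symm (φ y'')) := by
      rw [φ.left_inv h6]; exact h5.mdifferentiableAt one_ne_zero
    rw [sqrt_coordMetric, fderiv_comp_extChartAt_symm (φ.map_source h6) hd, φ.left_inv h6,
      coordField_mvfderiv_extChartAt h6] at h7
    exact h7
  · rw [dist_self, zero_add, dist_comm]
    exact hy'

end LocalComparison

/-! ### The soliton equation along a short minimizing geodesic -/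

set_option synthInstance.maxHeartbeats 200000

section LocalEquation

/-- A smooth function is Lipschitz and bounded on a small ball. -/
lemma exists_lipschitzOnWith_norm_le {E W : Type*} [NormedAddCommGroup E] [NormedSpace ℝ E]
    [NormedAddCommGroup W] [NormedSpace ℝ W] {G : E → W} {U : Set E} (hU : IsOpen U)
    (hG : ContDiffOn ℝ ∞ G U) {z : E} (hz : z ∈ U) :
    ∃ L : ℝ≥0, ∃ C : ℝ, ∃ r > 0, LipschitzOnWith L G (Metric.ball z r) ∧
      ∀ y ∈ Metric.ball z r, ‖G y‖ ≤ C := by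
  have hGz := hG.contDiffAt (hU.mem_nhds hz)
  obtain ⟨L, t, ht, hL⟩ := (hGz.of_le (m := 1) (by simp)).exists_lipschitzOnWith
  have h1 : ∀ᶠ y in 𝓝 z, ‖G y‖ < ‖G z‖ + 1 :=
    hGz.continuousAt.norm.eventually (Iio_mem_nhds (lt_add_one _))
  obtain ⟨r, hr0, hr⟩ := Metric.eventually_nhds_iff_ball.1
    (h1.and (Filter.eventually_mem_set.2 ht))
  exact ⟨L, ‖G z‖ + 1, r, hr0, hL.mono fun y hy => (hr y hy).2, fun y hy => (hr y hy).1.le⟩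

variable {n : ℕ} {M : Type*} [MetricSpace M] [ChartedSpace (EuclideanSpace ℝ (Fin n)) M]
  [IsManifold (𝓡 n) ∞ M] [RiemannianBundle (fun x : M => TangentSpace (𝓡 n) x)]

omit [RiemannianBundle (fun x : M => TangentSpace (𝓡 n) x)] in
/-- In the chart at `p`, the velocity of a curve is the derivative of its coordinate expression. -/
lemma velocity_eq_coordField {p : M} {γ : ℝ → M} {s₀ s : ℝ} (hs : s ∈ Ioo 0 s₀)
    (hγ : ∀ᶠ t in 𝓝 s, γ t ∈ (extChartAt (𝓡 n) p).source) {v : EuclideanSpace ℝ (Fin n)}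
    (hv : HasDerivAt (extChartAt (𝓡 n) p ∘ γ) v s) :
    MDifferentiableAt 𝓘(ℝ, ℝ) (𝓡 n) γ s ∧ velocity γ s₀ s = coordField p v (γ s) := by
  have hsrc := hγ.self_of_nhds
  have hmd : MDifferentiableAt 𝓘(ℝ, ℝ) (𝓡 n) γ s := by
    have h1 : MDifferentiableAt 𝓘(ℝ, ℝ) (𝓡 n)
        ((extChartAt (𝓡 n) p).symm ∘ (extChartAt (𝓡 n) p ∘ γ)) s :=
      (mdifferentiableAt_extChartAt_symm ((extChartAt (𝓡 n) p).map_source hsrc)).comp s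
        hv.differentiableAt.mdifferentiableAt
    refine h1.congr_of_eventuallyEq ?_
    filter_upwards [hγ] with t ht
    exact ((extChartAt (𝓡 n) p).left_inv ht).symm
  refine ⟨hmd, ?_⟩
  have h2 : velocity γ s₀ s = mfderiv 𝓘(ℝ, ℝ) (𝓡 n) γ s (1 : ℝ) := by
    rw [velocity, mfderivWithin_of_mem_nhds (Icc_mem_nhds hs.1 hs.2)]
  have h3 : mvfderiv (𝓡 n) (extChartAt (𝓡 n) p) (γ s) (mfderiv 𝓘(ℝ, ℝ) (𝓡 n) γ s (1 : ℝ)) = v := by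
    have h4 := mfderiv_comp s (mdifferentiableAt_extChartAt (I := 𝓡 n) (x := p)
      (by simpa using hsrc)) hmd
    have h5 : mfderiv 𝓘(ℝ, ℝ) 𝓘(ℝ, EuclideanSpace ℝ (Fin n)) (extChartAt (𝓡 n) p ∘ γ) s (1 : ℝ)
        = v := by
      rw [mfderiv_eq_fderiv]
      exact hv.deriv
    rw [h4] at h5
    exact h5
  rw [h2, ← coordField_mvfderiv_extChartAt hsrc (mfderiv 𝓘(ℝ, ℝ) (𝓡 n) γ s (1 : ℝ))]
  congr 1

variable [IsContMDiffRiemannianBundle (𝓡 n) ∞ (EuclideanSpace ℝ (Fin n))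
          (fun x : M => TangentSpace (𝓡 n) x)]
  [IsRiemannianManifold (𝓡 n) M]

/-- A curve parametrized by arc length in the metric sense has unit velocity wherever it is
differentiable. -/
lemma norm_velocity_eq_one {p : M} {γ : ℝ → M} {s₀ s : ℝ} (hs : s ∈ Ioo 0 s₀)
    (hmin : IsMinimizingNormalGeodesic γ s₀)
    (hγ : ∀ᶠ t in 𝓝 s, γ t ∈ (extChartAt (𝓡 n) p).source) {v : EuclideanSpace ℝ (Fin n)}
    (hv : HasDerivAt (extChartAt (𝓡 n) p ∘ γ) v s) : ‖velocity (n := n) γ s₀ s‖ = 1 := by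
  obtain ⟨hmd, hvel⟩ := velocity_eq_coordField (n := n) hs hγ hv
  have hsrc := hγ.self_of_nhds
  have hsrc' : γ s ∈ (chartAt (EuclideanSpace ℝ (Fin n)) p).source := by simpa using hsrc
  set φ := extChartAt (𝓡 n) p with hφ
  have hz := φ.map_source hsrc
  set N := ‖velocity (n := n) γ s₀ s‖ with hN
  have hN2 : √(coordMetric p (φ (γ s)) v v) = N := by
    rw [sqrt_coordMetric, φ.left_inv hsrc, hN, hvel]
  have hI : ∀ᶠ t in 𝓝 s, t ∈ Icc 0 s₀ := Icc_mem_nhds hs.1 hs.2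
  refine le_antisymm ?_ ?_
  · -- the function with differential `g(γ', ·)` grows at rate `N ^ 2` along the curve
    have key : ∀ ε > 0, N ^ 2 ≤ N + ε := by
      intro ε hε
      have hu : ∀ᶠ y in 𝓝 (γ s), ContMDiffAt (𝓡 n) 𝓘(ℝ, ℝ) 1
          (fun y => coordMetric p (φ (γ s)) v (φ y)) y := by
        filter_upwards [(isOpen_extChartAt_source (I := 𝓡 n) p).mem_nhds hsrc] with y hy
        exact (coordMetric p (φ (γ s)) v).contMDiff.contMDiffAt.comp y
          (contMDiffAt_extChartAt' (by rwa [extChartAt_source] at hy))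
      have hd : ∀ w : TangentSpace (𝓡 n) (γ s), |mvfderiv (𝓡 n)
          (fun y => coordMetric p (φ (γ s)) v (φ y)) (γ s) w| ≤ N * ‖w‖ := by
        intro w
        have h1 : mvfderiv (𝓡 n) (fun y => coordMetric p (φ (γ s)) v (φ y)) (γ s) w
            = coordMetric p (φ (γ s)) v (mvfderiv (𝓡 n) φ (γ s) w) := by
          have h2 := mfderiv_comp (γ s)
            ((coordMetric p (φ (γ s)) v).differentiableAt (x := φ (γ s))).mdifferentiableAt
            (mdifferentiableAt_extChartAt (I := 𝓡 n) (x := p) hsrc')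
          have h3 := congr($h2 w)
          rw [mfderiv_eq_fderiv, ContinuousLinearMap.fderiv] at h3
          exact h3
        rw [h1, coordMetric_apply, φ.left_inv hsrc, coordField_mvfderiv_extChartAt hsrc, ← hvel]
        exact abs_real_inner_le_norm _ _
      have h1 := eventually_abs_sub_le hu (norm_nonneg _) hd hε
      have hder : HasDerivAt (fun t => coordMetric p (φ (γ s)) v (φ (γ t)))
          (coordMetric p (φ (γ s)) v v) s :=
        (coordMetric p (φ (γ s)) v).hasFDerivAt.comp_hasDerivAt s hv
      have h2 := hder.le_of_lip' (C := N + ε) (by positivity) (by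
        filter_upwards [hmd.continuousAt.eventually h1, hI] with t ht htI
        rw [Real.norm_eq_abs, Real.norm_eq_abs]
        refine ht.trans (le_of_eq ?_)
        rw [hmin s ⟨hs.1.le, hs.2.le⟩ t htI, abs_sub_comm])
      have h3 : N ^ 2 = coordMetric p (φ (γ s)) v v := by
        rw [← hN2, Real.sq_sqrt (by rw [coordMetric_self]; positivity)]
      rw [h3]
      exact (le_abs_self _).trans h2
    have h4 : N ^ 2 ≤ N := le_of_forall_pos_le_add key
    have h5 : 0 ≤ N := norm_nonneg _
    nlinarith
  · rw [← hN2]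
    refine le_sqrt_of_hasDerivAt (Ψ := φ.symm) (Y := φ ∘ γ)
      (fun ε hε => eventually_dist_extChartAt_symm_le hz hε) hv (hasDerivAt_id s) ?_
    have h1 : ∀ᶠ t in 𝓝[>] s, γ t ∈ φ.source ∧ t ∈ Icc 0 s₀ := nhdsWithin_le_nhds (hγ.and hI)
    filter_upwards [h1, self_mem_nhdsWithin] with t ht hts
    simp only [Function.comp_apply]
    rw [φ.left_inv hsrc, φ.left_inv ht.1, hmin s ⟨hs.1.le, hs.2.le⟩ t ht.2, abs_sub_comm]
    exact le_abs_self _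

variable {q : Π x : M, TangentSpace (𝓡 n) x →L[ℝ] TangentSpace (𝓡 n) x →L[ℝ] ℝ} {f : M → ℝ}
  {lam : ℝ}

/-- The restriction of the equation `Hess f = lam g + (1/2) q` to a minimizing geodesic
`γ : [0, s₀] → M`, on the subinterval `(a, b)`. As nothing is known a priori about the regularity
of `γ`, the equation `2 (f ∘ γ)'' = 2 lam + q(γ', γ')` is stated in the weak form, tested against
Lipschitz functions. -/
structure WeakHessianEquation
    (q : Π x : M, TangentSpace (𝓡 n) x →L[ℝ] TangentSpace (𝓡 n) x →L[ℝ] ℝ) (f : M → ℝ) (lam : ℝ)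
    (γ : ℝ → M) (s₀ a b : ℝ) : Prop where
  ae_velocity : ∀ᵐ s ∂volume.restrict (Ioo a b), ‖velocity (n := n) γ s₀ s‖ = 1 ∧
    HasDerivAt (f ∘ γ) (inner ℝ (grad (n := n) f (γ s)) (velocity (n := n) γ s₀ s)) s
  integrableOn_tensor : IntegrableOn
    (fun s => q (γ s) (velocity (n := n) γ s₀ s) (velocity (n := n) γ s₀ s)) (Ioo a b)
  weak_eq : ∀ (L : ℝ≥0) (ψ : ℝ → ℝ), LipschitzOnWith L ψ (Icc a b) → ψ a = 0 → ψ b = 0 →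
    ∫ s in Ioo a b, (ψ s * (2 * lam
        + q (γ s) (velocity (n := n) γ s₀ s) (velocity (n := n) γ s₀ s))
      + 2 * deriv ψ s * deriv (f ∘ γ) s) = 0

set_option maxHeartbeats 1000000 in
/-- Every point has a ball in which the soliton equation holds weakly along minimizing geodesics:
the first variation formula in the chart at `x`, for the vector field `∇f`. -/
theorem IsGradientQSoliton.exists_ball_weakHessianEquation (h : IsGradientQSoliton q f lam)
    (x : M) : ∃ r > 0, ∀ (γ : ℝ → M) (s₀ a b : ℝ), 0 ≤ a → a ≤ b → b ≤ s₀ →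
      IsMinimizingNormalGeodesic γ s₀ → MapsTo γ (Icc a b) (Metric.ball x r) →
      WeakHessianEquation q f lam γ s₀ a b := by
  set φ := extChartAt (𝓡 n) x with hφ
  have hx := mem_extChartAt_source (I := 𝓡 n) x
  have hz := φ.map_source hx
  have hto := isOpen_extChartAt_target (I := 𝓡 n) x
  have hso := isOpen_extChartAt_source (I := 𝓡 n) x
  obtain ⟨LG, CG, r₁, hr₁, hGL, hGb⟩ := exists_lipschitzOnWith_norm_le
    (W := EuclideanSpace ℝ (Fin n) →L[ℝ] EuclideanSpace ℝ (Fin n) →L[ℝ] ℝ) hto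
    (contDiffOn_coordMetric x) hz
  obtain ⟨LV, CV, r₂, hr₂, hVL, hVb⟩ := exists_lipschitzOnWith_norm_le hto
    (contDiffOn_coordGrad x h.smooth_potential) hz
  obtain ⟨r₃, hr₃, hB₃⟩ := Metric.isOpen_iff.1 hto _ hz
  obtain ⟨r₄, hr₄, hB₄⟩ : ∃ r > 0, ∀ z ∈ Metric.ball (φ x) r,
      ‖coordTensor x q z‖ < ‖coordTensor x q (φ x)‖ + 1 := by
    have h1 : ContinuousAt (coordTensor x q) (φ x) :=
      (h.continuousOn_coordTensor x).continuousAt (hto.mem_nhds hz)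
    exact Metric.eventually_nhds_iff_ball.1
      ((ContinuousAt.norm (E := EuclideanSpace ℝ (Fin n) →L[ℝ] EuclideanSpace ℝ (Fin n) →L[ℝ] ℝ)
        h1).eventually (Iio_mem_nhds (lt_add_one _)))
  obtain ⟨ρ, hρ, hρ₁, hρ₂, hρ₃, hρ₄⟩ : ∃ ρ > 0, ρ ≤ r₁ ∧ ρ ≤ r₂ ∧ ρ ≤ r₃ ∧ ρ ≤ r₄ :=
    ⟨min (min r₁ r₂) (min r₃ r₄), by positivity, by simp, by simp, by simp, by simp⟩
  have hBt : Metric.ball (φ x) ρ ⊆ φ.target := (Metric.ball_subset_ball hρ₃).trans hB₃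
  have hCG : 0 ≤ CG := (norm_nonneg (coordMetric x (φ x))).trans
    (hGb _ (Metric.mem_ball_self hr₁))
  have hlip : LipschitzOnWith (√CG).toNNReal φ.symm (Metric.ball (φ x) ρ) := by
    refine LipschitzOnWith.of_dist_le_mul fun z h₁ z' h₂ => ?_
    have hseg : segment ℝ z z' ⊆ Metric.ball (φ x) ρ := (convex_ball _ _).segment_subset h₁ h₂
    refine dist_extChartAt_symm_le (by positivity) (hseg.trans hBt) fun y hy => ?_
    rw [Real.coe_toNNReal _ (Real.sqrt_nonneg _), mul_pow, Real.sq_sqrt hCG, dist_comm,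
      dist_eq_norm]
    refine (le_abs_self _).trans (((coordMetric x y).le_opNorm₂ _ _).trans ?_)
    rw [pow_two, ← mul_assoc]
    gcongr
    exact hGb _ (Metric.ball_subset_ball hρ₁ (hseg hy))
  obtain ⟨K, r₅, hr₅, hφL⟩ := exists_lipschitzOnWith_extChartAt (n := n) hx
  obtain ⟨r, hr, hrB⟩ : ∃ r > 0, Metric.ball x r ⊆
      φ.source ∩ φ ⁻¹' (Metric.ball (φ x) (ρ / 2)) ∩ Metric.ball x r₅ := by
    refine Metric.mem_nhds_iff.1 (Filter.inter_mem (Filter.inter_mem (hso.mem_nhds hx) ?_)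
      (Metric.ball_mem_nhds x hr₅))
    exact (continuousAt_extChartAt x).preimage_mem_nhds (Metric.ball_mem_nhds _ (half_pos hρ))
  refine ⟨r, hr, fun γ s₀ a b ha hab hb hmin hγ => ?_⟩
  have hIoo : Ioo a b ⊆ Icc a b := Ioo_subset_Icc_self
  have hsub : Icc a b ⊆ Icc 0 s₀ := Icc_subset_Icc ha hb
  have hγL : LipschitzOnWith 1 γ (Icc a b) := by
    refine LipschitzOnWith.of_dist_le_mul fun s hs t ht => ?_
    rw [hmin s (hsub hs) t (hsub ht), Real.dist_eq]
    simp
  have hcL : LipschitzOnWith (K * 1) (φ ∘ γ) (Icc a b) :=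
    hφL.comp hγL fun s hs => (hrB (hγ hs)).2
  have hcB : MapsTo (φ ∘ γ) (Icc a b) (Metric.ball (φ x) (ρ / 2)) := fun s hs =>
    (hrB (hγ hs)).1.2
  have hcB' : MapsTo (φ ∘ γ) (Icc a b) (Metric.ball (φ x) ρ) := fun s hs =>
    Metric.ball_subset_ball (by linarith) (hcB hs)
  have hsrc : ∀ s ∈ Icc a b, γ s ∈ φ.source := fun s hs => (hrB (hγ hs)).1.1
  have hae := ae_hasDerivAt_of_lipschitzOnWith hcL
  have haeI : ∀ᵐ s ∂volume.restrict (Ioo a b), s ∈ Ioo a b := ae_restrict_mem measurableSet_Ioo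
  have hvel : ∀ᵐ s ∂volume.restrict (Ioo a b), s ∈ Ioo a b ∧
      velocity (n := n) γ s₀ s = coordField x (deriv (φ ∘ γ) s) (γ s) ∧
      ‖velocity (n := n) γ s₀ s‖ = 1 ∧
      HasDerivAt (f ∘ γ) (inner ℝ (grad (n := n) f (γ s)) (velocity (n := n) γ s₀ s)) s := by
    filter_upwards [hae, haeI] with s hs hsI
    have hs0 : s ∈ Ioo 0 s₀ := ⟨ha.trans_lt hsI.1, hsI.2.trans_le hb⟩
    have hγs : ∀ᶠ t in 𝓝 s, γ t ∈ φ.source := by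
      filter_upwards [Icc_mem_nhds hsI.1 hsI.2] with t ht using hsrc t ht
    obtain ⟨hmd, hv⟩ := velocity_eq_coordField (n := n) hs0 hγs hs.1
    refine ⟨hsI, hv, norm_velocity_eq_one hs0 hmin hγs hs.1, ?_⟩
    have hfd : MDifferentiableAt (𝓡 n) 𝓘(ℝ, ℝ) f (φ.symm ((φ ∘ γ) s)) :=
      h.smooth_potential.mdifferentiable (by simp) _
    have hzs := hBt (hcB' (hIoo hsI))
    have h1 : HasDerivAt ((f ∘ φ.symm) ∘ (φ ∘ γ))
        (fderiv ℝ (f ∘ φ.symm) ((φ ∘ γ) s) (deriv (φ ∘ γ) s)) s := by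
      refine HasFDerivAt.comp_hasDerivAt s (DifferentiableAt.hasFDerivAt ?_) hs.1
      exact ((contDiffOn_comp_extChartAt_symm x h.smooth_potential).contDiffAt
        (hto.mem_nhds hzs)).differentiableAt (by simp)
    rw [fderiv_comp_extChartAt_symm hzs hfd, ← inner_grad] at h1
    have h2 : φ.symm ((φ ∘ γ) s) = γ s := φ.left_inv (hsrc s (hIoo hsI))
    rw [h2, ← hv] at h1
    refine h1.congr_of_eventuallyEq ?_
    filter_upwards [hγs] with t ht
    simp only [Function.comp_apply]
    rw [φ.left_inv ht]
  have hqeq : ∀ᵐ s ∂volume.restrict (Ioo a b),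
      coordTensor x q ((φ ∘ γ) s) (deriv (φ ∘ γ) s) (deriv (φ ∘ γ) s)
        = q (γ s) (velocity (n := n) γ s₀ s) (velocity (n := n) γ s₀ s) := by
    filter_upwards [hvel] with s hs
    have h2 : φ.symm ((φ ∘ γ) s) = γ s := φ.left_inv (hsrc s (hIoo hs.1))
    rw [coordTensor_apply, h2, ← hs.2.1]
  have hcc : ContinuousOn (φ ∘ γ) (Ioo a b) := hcL.continuousOn.mono hIoo
  refine ⟨hvel.mono fun s hs => hs.2.2, ?_, ?_⟩
  · have hm : AEStronglyMeasurable (fun s => coordTensor x q ((φ ∘ γ) s)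
        (deriv (φ ∘ γ) s) (deriv (φ ∘ γ) s)) (volume.restrict (Ioo a b)) := by
      have h1 : AEStronglyMeasurable (fun s => coordTensor x q ((φ ∘ γ) s))
          (volume.restrict (Ioo a b)) :=
        ((h.continuousOn_coordTensor x).comp hcc
          fun s hs => hBt (hcB' (hIoo hs))).aestronglyMeasurable measurableSet_Ioo
      have h2 : AEStronglyMeasurable (deriv (φ ∘ γ)) (volume.restrict (Ioo a b)) :=
        (stronglyMeasurable_deriv _).aestronglyMeasurable
      exact aestronglyMeasurable_clm_apply_apply h1 h2 h2
    have hi : Integrable (fun s => coordTensor x q ((φ ∘ γ) s)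
        (deriv (φ ∘ γ) s) (deriv (φ ∘ γ) s)) (volume.restrict (Ioo a b)) := by
      refine Integrable.of_bound hm
        ((‖coordTensor x q (φ x)‖ + 1) * (K * 1 : ℝ≥0) * (K * 1 : ℝ≥0)) ?_
      filter_upwards [hae, haeI] with s hs hsI
      refine ((coordTensor x q ((φ ∘ γ) s)).le_opNorm₂ _ _).trans ?_
      have h1 := (hB₄ _ (Metric.ball_subset_ball hρ₄ (hcB' (hIoo hsI)))).le
      gcongr
      · exact hs.2
      · exact hs.2
    exact hi.congr hqeq
  · intro L ψ hψ hψa hψb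
    have hfv := first_variation (Ψ := φ.symm) (G := coordMetric x) (V := coordGrad x f)
      (z₀ := φ x) (ρ := ρ) (CG := CG) (CV := CV) (c := φ ∘ γ) (ψ := ψ) (a := a) (b := b)
      (fun z hz ε hε => eventually_dist_extChartAt_symm_le (hBt hz) hε) hlip
      (coordMetric_comm x) (fun z v => by rw [coordMetric_self]; positivity)
      (hGL.mono (Metric.ball_subset_ball hρ₁))
      (fun z hz => ((contDiffOn_coordMetric x).contDiffAt
        (hto.mem_nhds (hBt hz))).differentiableAt (by simp))
      (fun z hz => hGb z (Metric.ball_subset_ball hρ₁ hz))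
      (hVL.mono (Metric.ball_subset_ball hρ₂))
      (fun z hz => ((contDiffOn_coordGrad x h.smooth_potential).contDiffAt
        (hto.mem_nhds (hBt hz))).differentiableAt (by simp))
      (((contDiffOn_coordGrad x h.smooth_potential).continuousOn_fderiv_of_isOpen hto
        (by simp)).mono hBt)
      (fun z hz => hVb z (Metric.ball_subset_ball hρ₂ hz)) hab hcL hψ hcB hψa hψb
      (by
        simp only [Function.comp_apply]
        rw [φ.left_inv (hsrc a (left_mem_Icc.2 hab)), φ.left_inv (hsrc b (right_mem_Icc.2 hab)),
          hmin a (hsub (left_mem_Icc.2 hab)) b (hsub (right_mem_Icc.2 hab)), abs_sub_comm,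
          abs_of_nonneg (sub_nonneg.2 hab)])
      (by
        filter_upwards [hvel] with s hs
        have h2 : φ.symm ((φ ∘ γ) s) = γ s := φ.left_inv (hsrc s (hIoo hs.1))
        rw [coordMetric_self, h2, ← hs.2.1, hs.2.2.1, one_pow])
    rw [← hfv]
    refine integral_congr_ae ?_
    filter_upwards [hvel, hqeq] with s hs hqs
    have h2 : φ.symm ((φ ∘ γ) s) = γ s := φ.left_inv (hsrc s (hIoo hs.1))
    have hzs := hBt (hcB' (hIoo hs.1))
    have h3 : coordMetric x ((φ ∘ γ) s) (deriv (φ ∘ γ) s) (deriv (φ ∘ γ) s) = 1 := by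
      rw [coordMetric_self, h2, ← hs.2.1, hs.2.2.1, one_pow]
    have h4 : coordMetric x ((φ ∘ γ) s) (coordGrad x f ((φ ∘ γ) s)) (deriv (φ ∘ γ) s)
        = deriv (f ∘ γ) s := by
      rw [coordMetric_apply, coordField_coordGrad hzs, h2, ← hs.2.1, hs.2.2.2.deriv]
    rw [h.coord_eq hzs, h4, h3, ← hqs, mul_one]

end LocalEquation

/-! ### Existence of minimizing geodesics -/

section LengthSpaces
variable {X : Type*} [MetricSpace X]

/-- A metric space is an approximate length space when any two points are joined by maps that
increase the distances of `[0, d]` by an arbitrarily small additive error only. These maps need not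
be continuous. -/
def HasAlmostGeodesics (X : Type*) [MetricSpace X] : Prop :=
  ∀ x y : X, ∀ ε > 0, ∃ σ : ℝ → X, σ 0 = x ∧ σ (dist x y) = y ∧
    ∀ s ∈ Icc 0 (dist x y), ∀ t ∈ Icc 0 (dist x y), dist (σ s) (σ t) ≤ |s - t| + ε

lemma HasAlmostGeodesics.exists_mem_closedBall (H : HasAlmostGeodesics X) {x y : X} {R δ ε : ℝ}
    (hR : 0 ≤ R) (hδ : 0 ≤ δ) (hε : 0 < ε) (hy : y ∈ Metric.closedBall x (R + δ)) :
    ∃ z ∈ Metric.closedBall x R, dist y z ≤ δ + ε := by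
  rw [Metric.mem_closedBall, dist_comm] at hy
  rcases le_or_gt (dist x y) R with h | h
  · exact ⟨y, by rwa [Metric.mem_closedBall, dist_comm], by rw [dist_self]; positivity⟩
  rcases lt_or_ge R (ε / 2) with h1 | h1
  · exact ⟨x, Metric.mem_closedBall_self hR, by rw [dist_comm]; linarith⟩
  obtain ⟨σ, h0, h2, hσ⟩ := H x y (ε / 2) (by positivity)
  have hd : (0 : ℝ) ≤ dist x y := dist_nonneg
  have hm : R - ε / 2 ∈ Icc 0 (dist x y) := ⟨by linarith, by linarith⟩
  refine ⟨σ (R - ε / 2), ?_, ?_⟩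
  · have h3 := hσ _ hm 0 ⟨le_rfl, hd⟩
    rw [h0, sub_zero, abs_of_nonneg hm.1] at h3
    rw [Metric.mem_closedBall]
    linarith
  · have h3 := hσ _ ⟨hd, le_rfl⟩ _ hm
    rw [h2, abs_of_nonneg (by linarith [hm.2])] at h3
    linarith

/-- The Hopf–Rinow–Cohn-Vossen theorem: bounded closed sets of a complete, locally compact length
space are compact. -/
lemma HasAlmostGeodesics.properSpace [CompleteSpace X] [LocallyCompactSpace X]
    (H : HasAlmostGeodesics X) : ProperSpace X := by
  refine ProperSpace.of_isCompact_closedBall_of_le 0 fun x R _ => ?_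
  by_contra hR
  set S : Set ℝ := {r | 0 ≤ r ∧ IsCompact (Metric.closedBall x r)} with hS
  have h0 : (0 : ℝ) ∈ S := ⟨le_rfl, by simp⟩
  have hbdd : BddAbove S := by
    refine ⟨R, fun r hr => ?_⟩
    by_contra! h
    exact hR (hr.2.of_isClosed_subset Metric.isClosed_closedBall
      (Metric.closedBall_subset_closedBall h.le))
  set T := sSup S with hT
  have hT0 : 0 ≤ T := le_csSup hbdd h0
  have hcomp : IsCompact (Metric.closedBall x T) := by
    refine isCompact_iff_totallyBounded_isComplete.2 ⟨?_, Metric.isClosed_closedBall.isComplete⟩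
    refine Metric.totallyBounded_iff.2 fun ε hε => ?_
    obtain ⟨r, hr, hrT⟩ := exists_lt_of_lt_csSup ⟨0, h0⟩ (show T - ε / 4 < sSup S by linarith)
    obtain ⟨t, ht, htr⟩ := Metric.totallyBounded_iff.1 hr.2.totallyBounded (ε / 4) (by positivity)
    refine ⟨t, ht, fun y hy => ?_⟩
    obtain ⟨z, hz, hyz⟩ := H.exists_mem_closedBall (x := x) (y := y) (R := r) (δ := ε / 4)
      (ε := ε / 4) hr.1 (by positivity) (by positivity)
      (Metric.closedBall_subset_closedBall (by linarith) hy)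
    obtain ⟨w, hw, hzw⟩ := mem_iUnion₂.1 (htr hz)
    refine mem_iUnion₂.2 ⟨w, hw, ?_⟩
    rw [Metric.mem_ball] at hzw ⊢
    linarith [dist_triangle y z w]
  obtain ⟨δ, hδ, hcδ⟩ := hcomp.exists_isCompact_cthickening
  have h1 : T + δ / 2 ∈ S := by
    refine ⟨by positivity, hcδ.of_isClosed_subset Metric.isClosed_closedBall fun y hy => ?_⟩
    obtain ⟨z, hz, hyz⟩ := H.exists_mem_closedBall hT0 (by positivity) (half_pos hδ) hy
    exact Metric.mem_cthickening_of_dist_le _ z _ _ hz (by linarith)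
  linarith [le_csSup hbdd h1]

/-- In a proper approximate length space, any two points are joined by a minimizing geodesic: a
pointwise limit of almost geodesics along an ultrafilter. -/
lemma HasAlmostGeodesics.exists_isMinimizingNormalGeodesic [ProperSpace X]
    (H : HasAlmostGeodesics X) (x y : X) :
    ∃ γ : ℝ → X, γ 0 = x ∧ γ (dist x y) = y ∧ IsMinimizingNormalGeodesic γ (dist x y) := by
  have hd : (0 : ℝ) ≤ dist x y := dist_nonneg
  choose σ h0 h1 hσ using fun k : ℕ => H x y (1 / ((k : ℝ) + 1)) (by positivity)
  have hlim : ∀ s ∈ Icc 0 (dist x y), ∃ z, Tendsto (fun k => σ k s) (hyperfilter ℕ) (𝓝 z) := by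
    intro s hs
    obtain ⟨z, -, hz⟩ := (isCompact_closedBall x (dist x y + 1)).ultrafilter_le_nhds
      ((hyperfilter ℕ).map fun k => σ k s) (by
        rw [le_principal_iff, Ultrafilter.coe_map]
        refine Filter.mem_map.2 (Filter.univ_mem' fun k => ?_)
        have h2 := hσ k s hs 0 ⟨le_rfl, hd⟩
        rw [h0, sub_zero, abs_of_nonneg hs.1] at h2
        have h3 : 1 / ((k : ℝ) + 1) ≤ 1 := by
          rw [div_le_one (by positivity)]
          linarith [(Nat.cast_nonneg k : (0 : ℝ) ≤ k)]
        rw [mem_preimage, Metric.mem_closedBall]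
        linarith [hs.2])
    exact ⟨z, hz⟩
  have : Nonempty X := ⟨x⟩
  choose! γ hγ using hlim
  have hle : ((hyperfilter ℕ : Ultrafilter ℕ) : Filter ℕ) ≤ atTop := by
    rw [← Nat.cofinite_eq_atTop]
    exact hyperfilter_le_cofinite
  have hlip : ∀ s ∈ Icc 0 (dist x y), ∀ t ∈ Icc 0 (dist x y), dist (γ s) (γ t) ≤ |s - t| := by
    intro s hs t ht
    have h2 : Tendsto (fun k : ℕ => |s - t| + 1 / ((k : ℝ) + 1)) (hyperfilter ℕ)
        (𝓝 (|s - t| + 0)) :=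
      (tendsto_one_div_add_atTop_nhds_zero_nat.const_add _).mono_left hle
    rw [add_zero] at h2
    exact le_of_tendsto_of_tendsto' ((hγ s hs).dist (hγ t ht)) h2 fun k => hσ k s hs t ht
  have hγ0 : γ 0 = x :=
    tendsto_nhds_unique (hγ 0 ⟨le_rfl, hd⟩) (by simpa only [h0] using tendsto_const_nhds)
  have hγ1 : γ (dist x y) = y :=
    tendsto_nhds_unique (hγ _ ⟨hd, le_rfl⟩) (by simpa only [h1] using tendsto_const_nhds)
  refine ⟨γ, hγ0, hγ1, ?_⟩
  have key : ∀ s ∈ Icc 0 (dist x y), ∀ t ∈ Icc 0 (dist x y), s ≤ t →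
      dist (γ s) (γ t) = |s - t| := by
    intro s hs t ht hst
    refine le_antisymm (hlip s hs t ht) ?_
    have h2 := hlip 0 ⟨le_rfl, hd⟩ s hs
    have h3 := hlip t ht _ ⟨hd, le_rfl⟩
    rw [hγ0, zero_sub, abs_neg, abs_of_nonneg hs.1] at h2
    rw [hγ1, abs_sub_comm, abs_of_nonneg (by linarith [ht.2])] at h3
    rw [abs_sub_comm, abs_of_nonneg (by linarith)]
    linarith [dist_triangle4 x (γ s) (γ t) y]
  intro s hs t ht
  rcases le_total s t with h | h
  · exact key s hs t ht h
  · rw [dist_comm, abs_sub_comm]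
    exact key t ht s hs h

end LengthSpaces

/-- Almost geodesics come from paths of almost minimal length, reparametrized by the distance from
the initial point. -/
lemma hasAlmostGeodesics (n : ℕ) (M : Type*) [MetricSpace M]
    [ChartedSpace (EuclideanSpace ℝ (Fin n)) M] [IsManifold (𝓡 n) ∞ M]
    [RiemannianBundle (fun x : M => TangentSpace (𝓡 n) x)] [IsRiemannianManifold (𝓡 n) M] :
    HasAlmostGeodesics M := by
  intro x y ε hε
  obtain ⟨p, hp0, hp1, hp, hl⟩ := exists_path_lt (n := n) x y (r := dist x y + ε) (by linarith)
  have hsum : ∀ t t', 0 ≤ t → t ≤ t' → t' ≤ 1 →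
      dist x (p t) + dist (p t) (p t') + dist (p t') y < dist x y + ε := by
    intro t t' h0 h1 h2
    have h3 : edist x (p t) + edist (p t) (p t') + edist (p t') y
        < ENNReal.ofReal (dist x y + ε) := by
      refine lt_of_le_of_lt ?_ hl
      rw [← Manifold.pathELength_add (h0.trans h1) h2, ← Manifold.pathELength_add h0 h1]
      rw [← hp0, ← hp1]
      gcongr
      · exact edist_le_pathELength hp h0
      · exact edist_le_pathELength hp h1
      · exact edist_le_pathELength hp h2
    rw [edist_dist, edist_dist, edist_dist, ← ENNReal.ofReal_add dist_nonneg dist_nonneg,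
      ← ENNReal.ofReal_add (by positivity) dist_nonneg] at h3
    exact (ENNReal.ofReal_lt_ofReal_iff_of_nonneg (by positivity)).1 h3
  have hex : ∀ s ∈ Icc 0 (dist x y), ∃ t ∈ Icc (0 : ℝ) 1, dist x (p t) = s ∧
      (s = dist x y → p t = y) := by
    intro s hs
    rcases eq_or_ne s (dist x y) with rfl | hne
    · exact ⟨1, ⟨zero_le_one, le_rfl⟩, by rw [hp1], fun _ => hp1⟩
    · have hc : ContinuousOn (fun t => dist x (p t)) (Icc 0 1) :=
        (continuous_const.dist hp.continuous).continuousOn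
      obtain ⟨t, ht, hts⟩ := intermediate_value_Icc zero_le_one hc
        (show s ∈ Icc (dist x (p 0)) (dist x (p 1)) by rwa [hp0, hp1, dist_self])
      exact ⟨t, ht, hts, fun h => (hne h).elim⟩
  choose! τ hτ hτs hτy using hex
  have hd : (0 : ℝ) ≤ dist x y := dist_nonneg
  refine ⟨p ∘ τ, ?_, hτy _ ⟨hd, le_rfl⟩ rfl, ?_⟩
  · exact (dist_eq_zero.1 (hτs 0 ⟨le_rfl, hd⟩)).symm
  have key : ∀ s ∈ Icc 0 (dist x y), ∀ t ∈ Icc 0 (dist x y), τ s ≤ τ t →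
      dist (p (τ s)) (p (τ t)) ≤ |s - t| + ε := by
    intro s hs t ht h
    have h1 := hsum _ _ (hτ s hs).1 h (hτ t ht).2
    have h2 := dist_triangle x (p (τ t)) y
    rw [hτs s hs] at h1
    rw [hτs t ht] at h2
    linarith [neg_abs_le (s - t)]
  intro s hs t ht
  rcases le_total (τ s) (τ t) with h | h
  · exact key s hs t ht h
  · simp only [Function.comp_apply]
    rw [dist_comm, abs_sub_comm]
    exact key t ht s hs h

/-! ### The soliton equation along a whole minimizing geodesic -/

section Patching

lemma exists_forall_abs_le_of_lipschitzOnWith {L : ℝ≥0} {ψ : ℝ → ℝ} {a b : ℝ}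
    (hψ : LipschitzOnWith L ψ (Icc a b)) : ∃ B, ∀ s ∈ Icc a b, |ψ s| ≤ B :=
  isCompact_Icc.exists_bound_of_continuousOn hψ.continuousOn

lemma exists_lipschitzOnWith_mul {L L' : ℝ≥0} {ψ χ : ℝ → ℝ} {a b : ℝ}
    (hψ : LipschitzOnWith L ψ (Icc a b)) (hχ : LipschitzOnWith L' χ (Icc a b)) :
    ∃ L'' : ℝ≥0, LipschitzOnWith L'' (fun s => ψ s * χ s) (Icc a b) := by
  obtain ⟨B, hB⟩ := exists_forall_abs_le_of_lipschitzOnWith hψ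
  obtain ⟨B', hB'⟩ := exists_forall_abs_le_of_lipschitzOnWith hχ
  refine ⟨(B * L' + B' * L).toNNReal, LipschitzOnWith.of_dist_le_mul fun s hs t ht => ?_⟩
  have h1 := hψ.dist_le_mul s hs t ht
  have h2 := hχ.dist_le_mul s hs t ht
  rw [Real.dist_eq] at h1 h2 ⊢
  have h3 : ψ s * χ s - ψ t * χ t = ψ s * (χ s - χ t) + χ t * (ψ s - ψ t) := by ring
  calc |ψ s * χ s - ψ t * χ t| ≤ |ψ s| * |χ s - χ t| + |χ t| * |ψ s - ψ t| := by
        rw [h3, ← abs_mul, ← abs_mul]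
        exact abs_add_le _ _
    _ ≤ B * (L' * dist s t) + B' * (L * dist s t) := by
        have := hB s hs
        have := hB' t ht
        have : 0 ≤ B := (abs_nonneg _).trans (hB s hs)
        have : 0 ≤ B' := (abs_nonneg _).trans (hB' t ht)
        gcongr
    _ = (B * L' + B' * L) * dist s t := by ring
    _ ≤ _ := by
        gcongr
        exact Real.le_coe_toNNReal _

lemma integrableOn_weak_integrand {L : ℝ≥0} {ψ κ p : ℝ → ℝ} {a b : ℝ}
    (hψ : LipschitzOnWith L ψ (Icc a b)) (hκ : IntegrableOn κ (Ioo a b))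
    (hp : IntegrableOn p (Ioo a b)) :
    IntegrableOn (fun s => ψ s * κ s + 2 * deriv ψ s * p s) (Ioo a b) := by
  obtain ⟨B, hB⟩ := exists_forall_abs_le_of_lipschitzOnWith hψ
  refine Integrable.add ?_ ?_
  · refine Integrable.bdd_mul (c := B) hκ
      ((hψ.continuousOn.mono Ioo_subset_Icc_self).aestronglyMeasurable measurableSet_Ioo) ?_
    filter_upwards [ae_restrict_mem measurableSet_Ioo] with s hs
    exact hB s (Ioo_subset_Icc_self hs)
  · refine Integrable.bdd_mul (c := 2 * L) hp
      ((stronglyMeasurable_deriv ψ).const_mul 2).aestronglyMeasurable ?_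
    filter_upwards [ae_hasDerivAt_of_lipschitzOnWith hψ] with s hs
    rw [norm_mul, Real.norm_ofNat]
    gcongr
    exact hs.2

/-- The weak equation `2 p' = κ` on the interval `(a, b)`, tested against Lipschitz functions that
vanish at the end points. -/
def WeakEquation (κ p : ℝ → ℝ) (a b : ℝ) : Prop :=
  ∀ (L : ℝ≥0) (ψ : ℝ → ℝ), LipschitzOnWith L ψ (Icc a b) → ψ a = 0 → ψ b = 0 →
    ∫ s in Ioo a b, (ψ s * κ s + 2 * deriv ψ s * p s) = 0

/-- A weak equation on two overlapping intervals holds on their union: split the test function by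
a piecewise linear partition of unity. -/
lemma WeakEquation.union {κ p : ℝ → ℝ} {a b' b c : ℝ} (h₁ : WeakEquation κ p a b)
    (h₂ : WeakEquation κ p b' c) (hab' : a ≤ b') (hb : b' < b) (hbc : b ≤ c)
    (hκ : IntegrableOn κ (Ioo a c)) (hp : IntegrableOn p (Ioo a c)) : WeakEquation κ p a c := by
  intro L ψ hψ hψa hψc
  set χ : ℝ → ℝ := fun s => max 0 (min 1 ((b - s) / (b - b'))) with hχ
  have hbb : 0 < b - b' := by linarith
  have hχL : LipschitzOnWith (1 / (b - b')).toNNReal χ (Icc a c) := by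
    have h : LipschitzWith (1 / (b - b')).toNNReal fun s => (b - s) / (b - b') := by
      refine LipschitzWith.of_dist_le_mul fun s t => ?_
      rw [Real.coe_toNNReal _ (by positivity), Real.dist_eq, Real.dist_eq, ← sub_div, abs_div,
        abs_of_pos hbb, sub_sub_sub_cancel_left, abs_sub_comm, one_div_mul_eq_div]
    exact ((h.const_min 1).const_max 0).lipschitzOnWith
  have hχ0 : ∀ s, b ≤ s → χ s = 0 := fun s hs =>
    max_eq_left ((min_le_right _ _).trans (div_nonpos_of_nonpos_of_nonneg (by linarith) hbb.le))
  have hχ1 : ∀ s, s ≤ b' → χ s = 1 := by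
    intro s hs
    have : 1 ≤ (b - s) / (b - b') := by rw [le_div_iff₀ hbb]; linarith
    simp only [hχ, min_eq_left this]
    norm_num
  have hχL' : LipschitzOnWith (0 + (1 / (b - b')).toNNReal) (fun s => 1 - χ s) (Icc a c) :=
    (LipschitzWith.const (1 : ℝ)).lipschitzOnWith.sub hχL
  obtain ⟨L₁, hL₁⟩ := exists_lipschitzOnWith_mul hψ hχL
  obtain ⟨L₂, hL₂⟩ := exists_lipschitzOnWith_mul hψ hχL'
  have hi₁ := integrableOn_weak_integrand hL₁ hκ hp
  have hi₂ := integrableOn_weak_integrand hL₂ hκ hp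
  have e₁ := h₁ L₁ _ (hL₁.mono (Icc_subset_Icc_right hbc)) (by simp [hψa])
    (by simp [hχ0 b le_rfl])
  have e₂ := h₂ L₂ _ (hL₂.mono (Icc_subset_Icc_left hab')) (by simp [hχ1 b' le_rfl])
    (by simp [hψc])
  have s₁ : ∫ s in Ioo a b, (ψ s * χ s * κ s + 2 * deriv (fun s => ψ s * χ s) s * p s)
      = ∫ s in Ioo a c, (ψ s * χ s * κ s + 2 * deriv (fun s => ψ s * χ s) s * p s) := by
    refine (setIntegral_eq_of_subset_of_ae_sdiff_eq_zero measurableSet_Ioo.nullMeasurableSet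
      (Ioo_subset_Ioo_right hbc) ?_).symm
    filter_upwards [compl_mem_ae_iff.2 (measure_singleton b)] with s hsb hs
    have hbs : b < s := lt_of_le_of_ne (not_lt.1 fun h => hs.2 ⟨hs.1.1, h⟩) (Ne.symm hsb)
    have h5 : (fun s => ψ s * χ s) =ᶠ[𝓝 s] fun _ => 0 := by
      filter_upwards [Ioi_mem_nhds hbs] with t ht
      rw [hχ0 t (le_of_lt ht), mul_zero]
    rw [h5.deriv_eq, hχ0 s hbs.le, deriv_const]
    ring
  have s₂ : ∫ s in Ioo b' c, (ψ s * (1 - χ s) * κ s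
        + 2 * deriv (fun s => ψ s * (1 - χ s)) s * p s)
      = ∫ s in Ioo a c, (ψ s * (1 - χ s) * κ s
        + 2 * deriv (fun s => ψ s * (1 - χ s)) s * p s) := by
    refine (setIntegral_eq_of_subset_of_ae_sdiff_eq_zero measurableSet_Ioo.nullMeasurableSet
      (Ioo_subset_Ioo_left hab') ?_).symm
    filter_upwards [compl_mem_ae_iff.2 (measure_singleton b')] with s hsb hs
    have hbs : s < b' := lt_of_le_of_ne (not_lt.1 fun h => hs.2 ⟨h, hs.1.2⟩) hsb
    have h5 : (fun s => ψ s * (1 - χ s)) =ᶠ[𝓝 s] fun _ => 0 := by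
      filter_upwards [Iio_mem_nhds hbs] with t ht
      rw [hχ1 t (le_of_lt ht), sub_self, mul_zero]
    rw [h5.deriv_eq, hχ1 s hbs.le, deriv_const]
    ring
  rw [← add_zero (0 : ℝ)]
  nth_rewrite 1 [← e₁]
  rw [← e₂, s₁, s₂, ← integral_add hi₁ hi₂]
  refine integral_congr_ae ?_
  filter_upwards [ae_hasDerivAt_of_lipschitzOnWith hL₁, ae_hasDerivAt_of_lipschitzOnWith hL₂]
    with s hs₁ hs₂
  have h3 : ψ = fun s => ψ s * χ s + ψ s * (1 - χ s) := by
    funext t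
    ring
  have h4 : deriv ψ s = deriv (fun s => ψ s * χ s) s + deriv (fun s => ψ s * (1 - χ s)) s := by
    have := (hs₁.1.add hs₂.1).deriv
    rw [← this]
    congr 1
  rw [h4]
  ring

variable {n : ℕ} {M : Type*} [MetricSpace M] [ChartedSpace (EuclideanSpace ℝ (Fin n)) M]
  [IsManifold (𝓡 n) ∞ M] [RiemannianBundle (fun x : M => TangentSpace (𝓡 n) x)]
  [IsContMDiffRiemannianBundle (𝓡 n) ∞ (EuclideanSpace ℝ (Fin n))
    (fun x : M => TangentSpace (𝓡 n) x)]
  [IsRiemannianManifold (𝓡 n) M]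
  {q : Π x : M, TangentSpace (𝓡 n) x →L[ℝ] TangentSpace (𝓡 n) x →L[ℝ] ℝ} {f : M → ℝ} {lam : ℝ}

/-- The soliton equation along a whole minimizing geodesic, in weak form. -/
theorem IsGradientQSoliton.weakHessianEquation (h : IsGradientQSoliton q f lam) {γ : ℝ → M}
    {s₀ : ℝ} (hs₀ : 0 ≤ s₀) (hmin : IsMinimizingNormalGeodesic γ s₀) {H : ℝ≥0}
    (hH : LipschitzOnWith H (f ∘ γ) (Icc 0 s₀)) :
    WeakHessianEquation q f lam γ s₀ 0 s₀ := by
  have hγL : LipschitzOnWith 1 γ (Icc 0 s₀) := by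
    refine LipschitzOnWith.of_dist_le_mul fun s hs t ht => ?_
    rw [hmin s hs t ht, Real.dist_eq]
    simp
  choose r hr hloc using h.exists_ball_weakHessianEquation
  obtain ⟨δ, hδ, hleb⟩ := lebesgue_number_lemma_of_metric
    (isCompact_Icc.image_of_continuousOn hγL.continuousOn)
    (c := fun x => Metric.ball x (r x)) (fun x => Metric.isOpen_ball)
    (fun y _ => mem_iUnion.2 ⟨y, Metric.mem_ball_self (hr y)⟩)
  have hshort : ∀ a b, 0 ≤ a → a ≤ b → b ≤ s₀ → b - a < δ →
      WeakHessianEquation q f lam γ s₀ a b := by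
    intro a b ha hab hb hd
    obtain ⟨x, hx⟩ := hleb (γ a) (mem_image_of_mem γ ⟨ha, hab.trans hb⟩)
    refine hloc x γ s₀ a b ha hab hb hmin fun s hs => hx ?_
    rw [Metric.mem_ball, hmin s ⟨ha.trans hs.1, hs.2.trans hb⟩ a ⟨ha, hab.trans hb⟩,
      abs_of_nonneg (sub_nonneg.2 hs.1)]
    linarith [hs.2]
  have hp : IntegrableOn (deriv (f ∘ γ)) (Ioo 0 s₀) := by
    refine Integrable.of_bound (stronglyMeasurable_deriv _).aestronglyMeasurable H ?_
    filter_upwards [ae_hasDerivAt_of_lipschitzOnWith hH] with s hs using hs.2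
  have hind : ∀ k : ℕ, ∀ b, 0 ≤ b → b ≤ s₀ → b ≤ k * (δ / 4) →
      WeakHessianEquation q f lam γ s₀ 0 b := by
    intro k
    induction k with
    | zero =>
      intro b hb hb' hbk
      refine hshort 0 b le_rfl hb hb' ?_
      simp only [Nat.cast_zero, zero_mul] at hbk
      linarith
    | succ k ih =>
      intro c hc hc' hck
      push_cast at hck
      rcases lt_or_ge c δ with hcδ | hcδ
      · exact hshort 0 c le_rfl hc hc' (by linarith)
      · obtain ⟨ae₁, i₁, w₁⟩ := ih (c - δ / 4) (by linarith) (by linarith) (by linarith)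
        obtain ⟨ae₂, i₂, w₂⟩ := hshort (c - δ / 2) c (by linarith) (by linarith) hc'
          (by linarith)
        have hsub : Ioo 0 c ⊆ Ioo 0 (c - δ / 4) ∪ Ioo (c - δ / 2) c := by
          intro s hs
          rcases lt_or_ge s (c - δ / 4) with h1 | h1
          · exact Or.inl ⟨hs.1, h1⟩
          · exact Or.inr ⟨by linarith, hs.2⟩
        have i₃ := (i₁.union i₂).mono_set hsub
        refine ⟨ae_mono (Measure.restrict_mono hsub le_rfl)
          ((ae_restrict_union_iff _ _ _).2 ⟨ae₁, ae₂⟩), i₃, ?_⟩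
        refine WeakEquation.union (κ := fun s => 2 * lam
          + q (γ s) (velocity (n := n) γ s₀ s) (velocity (n := n) γ s₀ s)) (p := deriv (f ∘ γ))
          w₁ w₂ (by linarith) (by linarith) (by linarith) ?_
          (hp.mono_set (Ioo_subset_Ioo_right hc'))
        exact Integrable.add (integrableOn_const (by simp)) i₃
  obtain ⟨k, hk⟩ := exists_nat_ge (s₀ / (δ / 4))
  exact hind k s₀ hs₀ le_rfl (by rwa [div_le_iff₀ (by positivity)] at hk)

end Patching

/-! ### The one-dimensional estimate -/

section OneDimensional

lemma integral_Ioo_add_Ioo {g : ℝ → ℝ} {a b c : ℝ} (hab : a ≤ b) (hbc : b ≤ c)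
    (hg : IntegrableOn g (Ioo a c)) :
    (∫ s in Ioo a b, g s) + ∫ s in Ioo b c, g s = ∫ s in Ioo a c, g s := by
  have h : ∀ u v, a ≤ u → u ≤ v → v ≤ c → IntervalIntegrable g volume u v := by
    intro u v h1 h2 h3
    rw [intervalIntegrable_iff_integrableOn_Ioo_of_le h2]
    exact hg.mono_set (Ioo_subset_Ioo h1 h3)
  rw [← integral_Ioc_eq_integral_Ioo, ← integral_Ioc_eq_integral_Ioo,
    ← integral_Ioc_eq_integral_Ioo, ← intervalIntegral.integral_of_le hab,
    ← intervalIntegral.integral_of_le hbc, ← intervalIntegral.integral_of_le (hab.trans hbc)]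
  exact intervalIntegral.integral_add_adjacent_intervals (h a b le_rfl hab hbc)
    (h b c hab hbc le_rfl)

lemma integral_Ioo_deriv_of_lipschitzOnWith {H : ℝ≥0} {h : ℝ → ℝ} {a b : ℝ} (hab : a ≤ b)
    (hh : LipschitzOnWith H h (Icc a b)) : ∫ s in Ioo a b, deriv h s = h b - h a := by
  rw [← integral_Ioc_eq_integral_Ioo, ← intervalIntegral.integral_of_le hab]
  rw [← uIcc_of_le hab] at hh
  exact hh.absolutelyContinuousOnInterval.integral_deriv_eq_sub

lemma deriv_eq_of_eqOn_Ioo {ψ g : ℝ → ℝ} {a b s : ℝ} (h : EqOn ψ g (Ioo a b)) (hs : s ∈ Ioo a b) :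
    deriv ψ s = deriv g s :=
  Filter.EventuallyEq.deriv_eq (h.eventuallyEq_of_mem (Ioo_mem_nhds hs.1 hs.2))

/-- The one-dimensional estimate. A function `h` with `h'' = lam + κ / 2` weakly, whose slope is at
least `-(G + 1)` near `0` and at most `A + lam (s₀ - s)` in absolute value on the last unit
interval, cannot live on a long interval if `-κ / 2` satisfies the index form inequality: compare
the test function `ψ` that is `1` away from the ends with the square of the cut-off function `φ`
that is linear on the two unit intervals at the ends. -/
lemma mul_sub_two_le_of_weakEquation {n : ℕ} {lam s₀ ε K G A : ℝ} {H : ℝ≥0} {κ h : ℝ → ℝ}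
    (hlam : 0 ≤ lam) (hs₀ : 2 ≤ s₀) (hε : ε ∈ Ioo (0 : ℝ) 1)
    (hκ : IntegrableOn κ (Ioo 0 s₀))
    (hweak : WeakEquation (fun s => 2 * lam + κ s) (deriv h) 0 s₀)
    (hindex : ∀ φ : ℝ → ℝ, (∃ L, LipschitzOnWith L φ (Icc 0 s₀)) → (∀ s ∈ Icc 0 s₀, 0 ≤ φ s) →
      φ 0 = 0 → φ s₀ = 0 → ∫ s in Ioo 0 s₀, φ s ^ 2 * (-(1 / 2) * κ s)
        ≤ ((n : ℝ) - 1) * ∫ s in Ioo 0 s₀, |deriv φ s| ^ 2)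
    (hh : LipschitzOnWith H h (Icc 0 s₀))
    (hκK : ∀ᵐ s ∂volume.restrict (Ioo (0 : ℝ) 1), |-(1 / 2) * κ s| ≤ K)
    (hG : -((G + 1) * ε) ≤ h ε - h 0)
    (hA : ∀ᵐ s ∂volume.restrict (Ioo (s₀ - 1) s₀), |deriv h s| ≤ A + lam * (s₀ - s)) :
    lam * (s₀ - 2) ≤ A + 2 / 3 * lam + G + 1 + K + 2 * n := by
  obtain ⟨hε0, hε1⟩ := hε
  set φ : ℝ → ℝ := fun t => min t 1 * min (s₀ - t) 1 with hφ
  set ψ : ℝ → ℝ := fun t => min (t / ε) 1 * (min (s₀ - t) 1 * min (s₀ - t) 1) with hψ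
  have hid : LipschitzWith 1 fun t : ℝ => t := LipschitzWith.id
  have l₁ : LipschitzOnWith 1 (fun t : ℝ => min t 1) (Icc 0 s₀) := (hid.min_const 1).lipschitzOnWith
  have l₂ : LipschitzOnWith (0 + 1) (fun t : ℝ => min (s₀ - t) 1) (Icc 0 s₀) :=
    (((LipschitzWith.const s₀).sub hid).min_const 1).lipschitzOnWith
  have l₃ : LipschitzOnWith (1 / ε).toNNReal (fun t : ℝ => min (t / ε) 1) (Icc 0 s₀) := by
    have : LipschitzWith (1 / ε).toNNReal fun t : ℝ => t / ε := by
      refine LipschitzWith.of_dist_le_mul fun s t => ?_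
      rw [Real.coe_toNNReal _ (by positivity), Real.dist_eq, Real.dist_eq, ← sub_div, abs_div,
        abs_of_pos hε0, one_div_mul_eq_div]
    exact (this.min_const 1).lipschitzOnWith
  obtain ⟨Lφ, hφL⟩ := exists_lipschitzOnWith_mul l₁ l₂
  obtain ⟨L', hL'⟩ := exists_lipschitzOnWith_mul l₂ l₂
  obtain ⟨Lψ, hψL⟩ := exists_lipschitzOnWith_mul l₃ hL'
  obtain ⟨L'', hφ2L⟩ := exists_lipschitzOnWith_mul hφL hφL
  -- the test functions on the four pieces of the interval
  have φ₁ : EqOn φ (fun t => t) (Ioo 0 1) := fun t ht => by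
    simp only [hφ]
    rw [min_eq_left ht.2.le, min_eq_right (by linarith [ht.2]), mul_one]
  have φ₂ : EqOn φ (fun _ => 1) (Ioo 1 (s₀ - 1)) := fun t ht => by
    simp only [hφ]
    rw [min_eq_right ht.1.le, min_eq_right (by linarith [ht.2]), mul_one]
  have φ₃ : EqOn φ (fun t => s₀ - t) (Ioo (s₀ - 1) s₀) := fun t ht => by
    simp only [hφ]
    rw [min_eq_right (by linarith [ht.1]), min_eq_left (by linarith [ht.1]), one_mul]
  have ψ₀ : EqOn ψ (fun t => t / ε) (Ioo 0 ε) := fun t ht => by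
    simp only [hψ]
    rw [min_eq_left ((div_le_one hε0).2 ht.2.le), min_eq_right (by linarith [ht.2]), mul_one,
      mul_one]
  have ψ₁ : EqOn ψ (fun _ => 1) (Ioo ε (s₀ - 1)) := fun t ht => by
    simp only [hψ]
    rw [min_eq_right ((one_le_div hε0).2 ht.1.le), min_eq_right (by linarith [ht.2]), mul_one,
      mul_one]
  have ψ₂ : EqOn ψ (fun t => (s₀ - t) * (s₀ - t)) (Ioo (s₀ - 1) s₀) := fun t ht => by
    simp only [hψ]
    rw [min_eq_right ((one_le_div hε0).2 (by linarith [ht.1])), min_eq_left (by linarith [ht.1]),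
      one_mul]
  have hp : IntegrableOn (deriv h) (Ioo 0 s₀) := by
    refine Integrable.of_bound (stronglyMeasurable_deriv _).aestronglyMeasurable H ?_
    filter_upwards [ae_hasDerivAt_of_lipschitzOnWith hh] with s hs using hs.2
  have hκ' : IntegrableOn (fun s => 2 * lam + κ s) (Ioo 0 s₀) :=
    Integrable.add (integrableOn_const (by simp)) hκ
  have i₁ := integrableOn_weak_integrand hψL hκ' hp
  have i₂ : IntegrableOn (fun s => φ s * φ s * κ s) (Ioo 0 s₀) := by
    have := integrableOn_weak_integrand (p := fun _ => 0) hφ2L hκ (by simp)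
    simpa using this
  set I : ℝ → ℝ := fun s => (ψ s * (2 * lam + κ s) + 2 * deriv ψ s * deriv h s)
    - φ s * φ s * κ s with hI
  have hIi : IntegrableOn I (Ioo 0 s₀) := Integrable.sub i₁ i₂
  have hsub : ∀ a b, 0 ≤ a → b ≤ s₀ → IntegrableOn I (Ioo a b) := fun a b ha hb =>
    hIi.mono_set (Ioo_subset_Ioo ha hb)
  -- the upper bound for the integral of `I`, from the index form inequality
  have hupper : ∫ s in Ioo 0 s₀, I s ≤ 4 * n := by
    have e₁ : ∫ s in Ioo 0 s₀, I s = 2 * ∫ s in Ioo 0 s₀, φ s ^ 2 * (-(1 / 2) * κ s) := by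
      rw [hI, integral_sub i₁ i₂, hweak Lψ ψ hψL (by simp [hψ]) (by simp [hψ]), zero_sub,
        ← integral_neg, ← integral_const_mul]
      congr 1
      funext s
      ring
    have e₂ := hindex φ ⟨Lφ, hφL⟩
      (fun s hs => mul_nonneg (le_min hs.1 zero_le_one) (le_min (by linarith [hs.2]) zero_le_one))
      (by simp [hφ]) (by simp [hφ])
    have hdi : IntegrableOn (fun s => |deriv φ s| ^ 2) (Ioo 0 s₀) := by
      refine Integrable.of_bound (((stronglyMeasurable_deriv φ).norm).pow 2).aestronglyMeasurable
        ((Lφ : ℝ) ^ 2) ?_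
      filter_upwards [ae_hasDerivAt_of_lipschitzOnWith hφL] with s hs
      rw [norm_pow, Real.norm_eq_abs, abs_abs]
      gcongr
      exact hs.2
    have e₃ : ∫ s in Ioo 0 s₀, |deriv φ s| ^ 2 = 2 := by
      have d₁ : EqOn (fun s => |deriv φ s| ^ 2) (fun _ => 1) (Ioo 0 1) := fun s hs => by
        simp only
        rw [deriv_eq_of_eqOn_Ioo φ₁ hs, deriv_id'']
        norm_num
      have d₂ : EqOn (fun s => |deriv φ s| ^ 2) (fun _ => 0) (Ioo 1 (s₀ - 1)) := fun s hs => by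
        simp only
        rw [deriv_eq_of_eqOn_Ioo φ₂ hs, deriv_const]
        norm_num
      have d₃ : EqOn (fun s => |deriv φ s| ^ 2) (fun _ => 1) (Ioo (s₀ - 1) s₀) := fun s hs => by
        simp only
        rw [deriv_eq_of_eqOn_Ioo φ₃ hs, deriv_const_sub, deriv_id'']
        norm_num
      rw [← integral_Ioo_add_Ioo (show (0 : ℝ) ≤ s₀ - 1 by linarith) (by linarith) hdi,
        ← integral_Ioo_add_Ioo zero_le_one (show (1 : ℝ) ≤ s₀ - 1 by linarith)
          (hdi.mono_set (Ioo_subset_Ioo_right (by linarith))),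
        setIntegral_congr_fun measurableSet_Ioo d₁, setIntegral_congr_fun measurableSet_Ioo d₂,
        setIntegral_congr_fun measurableSet_Ioo d₃]
      simp
      norm_num
    rw [e₃] at e₂
    rw [e₁]
    linarith
  -- lower bounds on the four pieces; on the first two, `0 ≤ ψ - φ² ≤ 1`
  have hlow₀ : 2 / ε * (h ε - h 0) - 2 * K * ε ≤ ∫ s in Ioo 0 ε, I s := by
    have hpε := hp.mono_set (Ioo_subset_Ioo_right (show ε ≤ s₀ by linarith))
    have e₁ : ∫ s in Ioo 0 ε, (2 / ε * deriv h s - 2 * K) = 2 / ε * (h ε - h 0) - 2 * K * ε := by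
      rw [integral_sub (hpε.const_mul _) (integrableOn_const (by simp)), integral_const_mul,
        integral_Ioo_deriv_of_lipschitzOnWith hε0.le
          (hh.mono (Icc_subset_Icc_right (by linarith)))]
      simp [hε0.le]
      ring
    rw [← e₁]
    refine setIntegral_mono_ae_restrict ((hpε.const_mul _).sub (integrableOn_const (by simp)))
      (hsub 0 ε le_rfl (by linarith)) ?_
    filter_upwards [ae_restrict_of_ae_restrict_of_subset (Ioo_subset_Ioo_right hε1.le) hκK,
      ae_restrict_mem measurableSet_Ioo] with s hsK hs
    have h1 : ψ s = s / ε := ψ₀ hs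
    have h2 : φ s = s := φ₁ ⟨hs.1, hs.2.trans hε1⟩
    have h3 : deriv ψ s = 1 / ε := by
      rw [deriv_eq_of_eqOn_Ioo ψ₀ hs, deriv_div_const, deriv_id'']
    have h4 : s / ε ≤ 1 := (div_le_one hε0).2 hs.2.le
    have h5 : s * s ≤ s / ε := by
      rw [le_div_iff₀ hε0]
      nlinarith [hs.1, hs.2, mul_pos hs.1 hs.1]
    have h6 : 0 ≤ s * s := mul_self_nonneg s
    have h7 : -(K * 1) ≤ (s / ε - s * s) * (1 / 2 * κ s) := by
      refine (neg_le_neg ?_).trans (neg_abs_le _)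
      rw [abs_mul, mul_comm K]
      have h8 : |1 / 2 * κ s| ≤ K := by rwa [← abs_neg, ← neg_mul]
      have h9 : |s / ε - s * s| ≤ 1 := by
        rw [abs_of_nonneg (by linarith)]
        linarith
      exact mul_le_mul h9 h8 (abs_nonneg _) zero_le_one
    have h10 : 0 ≤ lam * (s / ε) := mul_nonneg hlam (h6.trans h5)
    simp only [hI]
    rw [h1, h2, h3]
    have h11 : 2 * (1 / ε) * deriv h s = 2 / ε * deriv h s := by ring
    rw [h11]
    linarith
  have hlow₁ : -(2 * K * (1 - ε)) ≤ ∫ s in Ioo ε 1, I s := by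
    have e₁ : ∫ s in Ioo ε 1, -(2 * K) = -(2 * K * (1 - ε)) := by
      simp [hε1.le]
      ring
    rw [← e₁]
    refine setIntegral_mono_ae_restrict (integrableOn_const (by simp))
      (hsub ε 1 hε0.le (by linarith)) ?_
    filter_upwards [ae_restrict_of_ae_restrict_of_subset (Ioo_subset_Ioo_left hε0.le) hκK,
      ae_restrict_mem measurableSet_Ioo] with s hsK hs
    have hs' : s ∈ Ioo ε (s₀ - 1) := ⟨hs.1, by linarith [hs.2]⟩
    have h1 : ψ s = 1 := ψ₁ hs'
    have h2 : φ s = s := φ₁ ⟨hε0.trans hs.1, hs.2⟩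
    have h3 : deriv ψ s = 0 := by rw [deriv_eq_of_eqOn_Ioo ψ₁ hs', deriv_const]
    have h6 : 0 ≤ s * s := mul_self_nonneg s
    have h5 : s * s ≤ 1 := by nlinarith [hs.1, hs.2]
    have h7 : -(K * 1) ≤ (1 - s * s) * (1 / 2 * κ s) := by
      refine (neg_le_neg ?_).trans (neg_abs_le _)
      rw [abs_mul, mul_comm K]
      have h8 : |1 / 2 * κ s| ≤ K := by rwa [← abs_neg, ← neg_mul]
      have h9 : |1 - s * s| ≤ 1 := by
        rw [abs_of_nonneg (by linarith)]
        linarith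
      exact mul_le_mul h9 h8 (abs_nonneg _) zero_le_one
    simp only [hI]
    rw [h1, h2, h3]
    linarith
  have hlow₂ : 2 * lam * (s₀ - 2) ≤ ∫ s in Ioo 1 (s₀ - 1), I s := by
    have e₁ : ∫ s in Ioo 1 (s₀ - 1), 2 * lam = 2 * lam * (s₀ - 2) := by
      rw [setIntegral_const, Real.volume_real_Ioo_of_le (by linarith), smul_eq_mul]
      ring
    rw [← e₁]
    refine (setIntegral_congr_fun measurableSet_Ioo fun s hs => ?_).le
    have hs' : s ∈ Ioo ε (s₀ - 1) := ⟨hε1.trans hs.1, hs.2⟩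
    have h1 : ψ s = 1 := ψ₁ hs'
    have h2 : φ s = 1 := φ₂ hs
    have h3 : deriv ψ s = 0 := by rw [deriv_eq_of_eqOn_Ioo ψ₁ hs', deriv_const]
    simp only [hI]
    rw [h1, h2, h3]
    ring
  -- here `ψ = φ²`, so that `κ` drops out of `I`
  have hlow₃ : -(2 * A + 4 / 3 * lam) ≤ ∫ s in Ioo (s₀ - 1) s₀, I s := by
    have hc : Continuous fun s : ℝ => -(4 * (s₀ - s) * (A + lam * (s₀ - s))) := by fun_prop
    have e₁ : ∫ s in Ioo (s₀ - 1) s₀, -(4 * (s₀ - s) * (A + lam * (s₀ - s)))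
        = -(2 * A + 4 / 3 * lam) := by
      rw [← integral_Ioc_eq_integral_Ioo, ← intervalIntegral.integral_of_le (by linarith),
        intervalIntegral.integral_eq_sub_of_hasDerivAt
          (f := fun s => 2 * A * (s₀ - s) ^ 2 + 4 / 3 * lam * (s₀ - s) ^ 3) (fun s _ => ?_)
          (hc.intervalIntegrable _ _)]
      · ring
      · have h1 : HasDerivAt (fun s => s₀ - s) (-1) s := (hasDerivAt_id s).const_sub s₀
        refine (((h1.pow 2).const_mul (2 * A)).add
          ((h1.pow 3).const_mul (4 / 3 * lam))).congr_deriv ?_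
        norm_num
        ring
    rw [← e₁]
    refine setIntegral_mono_ae_restrict (hc.integrableOn_Icc.mono_set Ioo_subset_Icc_self)
      (hsub _ _ (by linarith) le_rfl) ?_
    filter_upwards [hA, ae_restrict_mem measurableSet_Ioo] with s hsA hs
    have h1 : ψ s = (s₀ - s) * (s₀ - s) := ψ₂ hs
    have h2 : φ s = s₀ - s := φ₃ hs
    have h3 : deriv ψ s = -(2 * (s₀ - s)) := by
      rw [deriv_eq_of_eqOn_Ioo ψ₂ hs]
      have h1 : HasDerivAt (fun s => s₀ - s) (-1) s := (hasDerivAt_id s).const_sub s₀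
      refine (h1.mul h1).deriv.trans ?_
      ring
    have h4 : 0 ≤ s₀ - s := by linarith [hs.2]
    have h5 : (s₀ - s) * deriv h s ≤ (s₀ - s) * (A + lam * (s₀ - s)) :=
      mul_le_mul_of_nonneg_left ((le_abs_self _).trans hsA) h4
    have h6 : 0 ≤ lam * ((s₀ - s) * (s₀ - s)) := mul_nonneg hlam (mul_self_nonneg _)
    simp only [hI]
    rw [h1, h2, h3]
    linarith
  have hG' : -(2 * (G + 1)) ≤ 2 / ε * (h ε - h 0) := by
    have := mul_le_mul_of_nonneg_left hG (show 0 ≤ 2 / ε by positivity)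
    refine le_trans (le_of_eq ?_) this
    field_simp
  have hsplit : (∫ s in Ioo 0 ε, I s) + (∫ s in Ioo ε 1, I s) + (∫ s in Ioo 1 (s₀ - 1), I s)
      + (∫ s in Ioo (s₀ - 1) s₀, I s) = ∫ s in Ioo 0 s₀, I s := by
    rw [integral_Ioo_add_Ioo hε0.le hε1.le (hsub _ _ le_rfl (by linarith)),
      integral_Ioo_add_Ioo zero_le_one (by linarith) (hsub _ _ le_rfl (by linarith)),
      integral_Ioo_add_Ioo (by linarith) (by linarith) hIi]
  linarith

end OneDimensional

/-! ### The growth estimate -/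

section Growth

set_option synthInstance.maxHeartbeats 200000

variable {n : ℕ} {M : Type*} [MetricSpace M] [ChartedSpace (EuclideanSpace ℝ (Fin n)) M]
  [IsManifold (𝓡 n) ∞ M] [RiemannianBundle (fun x : M => TangentSpace (𝓡 n) x)]

omit [IsManifold (𝓡 n) ∞ M] in
lemma abs_mvfderiv_le_norm_grad_mul (f : M → ℝ) (x : M) (w : TangentSpace (𝓡 n) x) :
    |mvfderiv (𝓡 n) f x w| ≤ ‖grad (n := n) f x‖ * ‖w‖ := by
  rw [← inner_grad]
  exact abs_real_inner_le_norm _ _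

lemma grad_eq_zero_of_isLocalMin {f : M → ℝ} {x : M} (hf : MDifferentiableAt (𝓡 n) 𝓘(ℝ, ℝ) f x)
    (hmin : IsLocalMin f x) : grad (n := n) f x = 0 := by
  have hx := mem_extChartAt_source (I := 𝓡 n) x
  set φ := extChartAt (𝓡 n) x with hφ
  have hz := φ.map_source hx
  have hxx : φ.symm (φ x) = x := φ.left_inv hx
  have hm : IsLocalMin (f ∘ φ.symm) (φ x) := by
    have hc : Tendsto φ.symm (𝓝 (φ x)) (𝓝 x) := by
      have := continuousAt_extChartAt_symm'' (I := 𝓡 n) (x := x) hz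
      rw [ContinuousAt, hxx] at this
      exact this
    filter_upwards [hc.eventually hmin] with z hz'
    simp only [Function.comp_apply]
    rwa [hxx]
  have h0 : mvfderiv (𝓡 n) f x (grad (n := n) f x) = 0 := by
    have h1 := fderiv_comp_extChartAt_symm (n := n) (p := x) (f := f) hz (by rwa [hxx])
      (mvfderiv (𝓡 n) φ x (grad (n := n) f x))
    rw [hm.fderiv_eq_zero, hxx, coordField_mvfderiv_extChartAt hx] at h1
    exact h1.symm
  rwa [← inner_grad, inner_self_eq_zero] at h0

omit [IsManifold (𝓡 n) ∞ M] in
/-- The quantity `w = f + C / lam` satisfies `|∇w|² ≤ 2 lam w`. -/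
lemma norm_grad_le_sqrt {f : M → ℝ} {lam C : ℝ} (hlam : 0 < lam)
    (hF : ∀ x, (1 / 2) * ‖grad (n := n) f x‖ ^ 2 - lam * f x ≤ C) (x : M) :
    0 ≤ f x + C / lam ∧ ‖grad (n := n) f x‖ ≤ √(2 * lam) * √(f x + C / lam) := by
  have h1 : ‖grad (n := n) f x‖ ^ 2 ≤ 2 * lam * (f x + C / lam) := by
    have h2 : 2 * lam * (f x + C / lam) = 2 * (lam * f x + C) := by field_simp
    linarith [hF x]
  refine ⟨?_, ?_⟩
  · by_contra! h
    nlinarith [sq_nonneg ‖grad (n := n) f x‖]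
  · rw [← Real.sqrt_mul (by positivity)]
    exact Real.le_sqrt_of_sq_le h1

variable [IsContMDiffRiemannianBundle (𝓡 n) ∞ (EuclideanSpace ℝ (Fin n))
    (fun x : M => TangentSpace (𝓡 n) x)]
  {q : Π x : M, TangentSpace (𝓡 n) x →L[ℝ] TangentSpace (𝓡 n) x →L[ℝ] ℝ} {f : M → ℝ} {lam C : ℝ}

/-- A continuous `(0,2)`-tensor is locally bounded. -/
lemma IsGradientQSoliton.exists_abs_tensor_le (h : IsGradientQSoliton q f lam) (x : M) :
    ∃ B, 0 ≤ B ∧ ∀ᶠ y in 𝓝 x, ∀ v : TangentSpace (𝓡 n) y, |q y v v| ≤ B * ‖v‖ ^ 2 := by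
  have hx := mem_extChartAt_source (I := 𝓡 n) x
  set φ := extChartAt (𝓡 n) x with hφ
  have hz := φ.map_source hx
  obtain ⟨A, hA0, hA⟩ := exists_norm_mfderiv_extChartAt_le (n := n) hx
  have h1 : ContinuousAt (coordTensor x q) (φ x) :=
    (h.continuousOn_coordTensor x).continuousAt
      ((isOpen_extChartAt_target (I := 𝓡 n) x).mem_nhds hz)
  have h2 := ((ContinuousAt.norm
    (E := EuclideanSpace ℝ (Fin n) →L[ℝ] EuclideanSpace ℝ (Fin n) →L[ℝ] ℝ) h1).eventually
      (Iio_mem_nhds (lt_add_one _)))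
  refine ⟨(‖coordTensor x q (φ x)‖ + 1) * A ^ 2, by positivity, ?_⟩
  filter_upwards [hA, (continuousAt_extChartAt x).eventually h2,
    (isOpen_extChartAt_source (I := 𝓡 n) x).mem_nhds hx] with y hy1 hy2 hy3 v
  have h3 : q y v v = coordTensor x q (φ y) (mvfderiv (𝓡 n) φ y v) (mvfderiv (𝓡 n) φ y v) := by
    rw [coordTensor_apply, φ.left_inv hy3, coordField_mvfderiv_extChartAt hy3]
  rw [h3]
  refine ((coordTensor x q (φ y)).le_opNorm₂ _ _).trans ?_
  have h4 : ‖coordTensor x q (φ y)‖ ≤ ‖coordTensor x q (φ x)‖ + 1 := le_of_lt hy2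
  calc ‖coordTensor x q (φ y)‖ * ‖mvfderiv (𝓡 n) φ y v‖ * ‖mvfderiv (𝓡 n) φ y v‖
      ≤ (‖coordTensor x q (φ x)‖ + 1) * (A * ‖v‖) * (A * ‖v‖) := by
        gcongr
        · exact hy1 v
        · exact hy1 v
    _ = (‖coordTensor x q (φ x)‖ + 1) * A ^ 2 * ‖v‖ ^ 2 := by ring

lemma IsGradientQSoliton.exists_boundedOnUnitBall [ProperSpace M]
    (h : IsGradientQSoliton q f lam) (x₀ : M) : ∃ K, BoundedOnUnitBall q x₀ K := by
  obtain ⟨B, hB0, hB⟩ : ∃ B, 0 ≤ B ∧ ∀ y ∈ Metric.closedBall x₀ 1,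
      ∀ v : TangentSpace (𝓡 n) y, |q y v v| ≤ B * ‖v‖ ^ 2 := by
    refine (isCompact_closedBall x₀ 1).induction_on
      (p := fun s => ∃ B, 0 ≤ B ∧ ∀ y ∈ s, ∀ v : TangentSpace (𝓡 n) y, |q y v v| ≤ B * ‖v‖ ^ 2)
      ⟨0, le_rfl, by simp⟩ ?_ ?_ ?_
    · rintro s t hst ⟨B, hB0, hB⟩
      exact ⟨B, hB0, fun y hy => hB y (hst hy)⟩
    · rintro s t ⟨B, hB0, hB⟩ ⟨B', hB0', hB'⟩
      refine ⟨B + B', by positivity, ?_⟩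
      rintro y (hy | hy) v
      · exact (hB y hy v).trans (by gcongr; linarith)
      · exact (hB' y hy v).trans (by gcongr; linarith)
    · intro x _
      obtain ⟨B, hB0, hB⟩ := h.exists_abs_tensor_le x
      exact ⟨_, mem_nhdsWithin_of_mem_nhds hB, B, hB0, fun y hy => hy⟩
  refine ⟨B, fun y hy v => ?_⟩
  have h1 := hB y (Metric.ball_subset_closedBall hy) v
  rw [abs_mul, abs_neg]
  norm_num
  have : 0 ≤ B * ‖v‖ ^ 2 := by positivity
  linarith

variable [IsRiemannianManifold (𝓡 n) M]

omit [IsManifold (𝓡 n) ∞ M] [IsContMDiffRiemannianBundle (𝓡 n) ∞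
    (EuclideanSpace ℝ (Fin n)) (fun x : M => TangentSpace (𝓡 n) x)] in
/-- The function `√(f + C / lam)` is `√(lam / 2)`-Lipschitz. As the square root is not
differentiable at `0`, `f + C / lam` is first replaced by `f + C / lam + η` with `η > 0`. -/
lemma abs_sqrt_sub_sqrt_le (hf : ContMDiff (𝓡 n) 𝓘(ℝ, ℝ) ∞ f) (hlam : 0 < lam)
    (hF : ∀ x, (1 / 2) * ‖grad (n := n) f x‖ ^ 2 - lam * f x ≤ C) (x y : M) :
    |√(f y + C / lam) - √(f x + C / lam)| ≤ √(lam / 2) * dist x y := by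
  have key : ∀ η > 0, |√(f y + C / lam + η) - √(f x + C / lam + η)| ≤ √(lam / 2) * dist x y := by
    intro η hη
    have hpos : ∀ z, 0 < f z + C / lam + η := fun z =>
      add_pos_of_nonneg_of_pos (norm_grad_le_sqrt hlam hF z).1 hη
    have hg : ∀ z, HasDerivAt (fun t : ℝ => √(t + C / lam + η))
        (1 / (2 * √(f z + C / lam + η))) (f z) := fun z =>
      (((hasDerivAt_id (f z)).add_const (C / lam)).add_const η).sqrt (hpos z).ne'
    have hu : ∀ z, ContMDiffAt (𝓡 n) 𝓘(ℝ, ℝ) 1 (fun z => √(f z + C / lam + η)) z := by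
      intro z
      have h1 : ContDiffAt ℝ 1 (fun t : ℝ => √(t + C / lam + η)) (f z) :=
        ((contDiffAt_id.add contDiffAt_const).add contDiffAt_const).sqrt (hpos z).ne'
      exact h1.contMDiffAt.comp z ((hf z).of_le (by simp))
    have hd : ∀ z, ∀ w : TangentSpace (𝓡 n) z,
        ‖mvfderiv (𝓡 n) (fun z => √(f z + C / lam + η)) z w‖ ≤ √(lam / 2) * ‖w‖ := by
      intro z w
      have h1 : mvfderiv (𝓡 n) (fun z => √(f z + C / lam + η)) z w
          = 1 / (2 * √(f z + C / lam + η)) * mvfderiv (𝓡 n) f z w := by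
        have h2 := mfderiv_comp z (hg z).differentiableAt.mdifferentiableAt
          ((hf.mdifferentiable (by simp)) z)
        have h3 := congr($h2 w)
        rw [mfderiv_eq_fderiv, (hg z).hasFDerivAt.fderiv] at h3
        refine h3.trans ?_
        refine (ContinuousLinearMap.toSpanSingleton_apply ..).trans ?_
        exact mul_comm (mvfderiv (𝓡 n) f z w) _
      have h2 := norm_grad_le_sqrt hlam hF z
      have h3 : √(f z + C / lam) ≤ √(f z + C / lam + η) := Real.sqrt_le_sqrt (by linarith)
      have h4 : 0 < √(f z + C / lam + η) := Real.sqrt_pos.2 (hpos z)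
      have h5 : √(2 * lam) = 2 * √(lam / 2) := by
        rw [show 2 * lam = 2 ^ 2 * (lam / 2) by ring, Real.sqrt_mul (by norm_num),
          Real.sqrt_sq (by norm_num)]
      rw [h1, norm_mul, Real.norm_eq_abs, Real.norm_eq_abs, abs_of_pos (by positivity)]
      calc 1 / (2 * √(f z + C / lam + η)) * |mvfderiv (𝓡 n) f z w|
          ≤ 1 / (2 * √(f z + C / lam + η)) * (√(2 * lam) * √(f z + C / lam + η) * ‖w‖) := by
            gcongr
            refine (abs_mvfderiv_le_norm_grad_mul f z w).trans ?_
            gcongr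
            exact h2.2.trans (by gcongr)
        _ = √(lam / 2) * ‖w‖ := by
            rw [h5]
            generalize √(f z + C / lam + η) = T at h4
            field_simp
    have := norm_sub_le_mul_dist (n := n) (x := x) (r := dist x y + 1) (c := √(lam / 2))
      (by positivity) (fun z _ => hu z) (fun z _ => hd z) (y := x) (y' := y)
      (by rw [dist_self]; linarith)
    exact this
  have hc : ContinuousWithinAt
      (fun η : ℝ => |√(f y + C / lam + η) - √(f x + C / lam + η)|) (Ioi 0) 0 := by fun_prop
  have h1 := le_of_tendsto hc.tendsto (by
    filter_upwards [self_mem_nhdsWithin] with η hη using key η hη)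
  simpa using h1

variable (n lam) in
/-- The constant of the growth estimate. The number `3` makes the geodesics in question so long that
the two end intervals of the test functions are disjoint, and it absorbs the terms that are
multiples of `lam`. -/
def growthConstant (K G : ℝ) : ℝ := 3 + (2 * n + |K| + |G| + 1) / lam

/-- The growth estimate, by the soliton equation along a minimizing geodesic from `x₀` to `x`. -/
theorem IsGradientQSoliton.growth [ProperSpace M] (h : IsGradientQSoliton q f lam)
    (hlam : 0 < lam) (hF : ∀ x, (1 / 2) * ‖grad (n := n) f x‖ ^ 2 - lam * f x ≤ C)
    (hq : IntegralInequality q) {x₀ : M} {K G : ℝ} (hK : BoundedOnUnitBall q x₀ K)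
    (hG : ‖grad (n := n) f x₀‖ ≤ G) (x : M) :
    lam / 2 * (max (dist x x₀ - growthConstant n lam K G) 0) ^ 2 ≤ f x + C / lam := by
  have hw := fun x => norm_grad_le_sqrt hlam hF x
  have hG0 : 0 ≤ G := (norm_nonneg _).trans hG
  rw [dist_comm]
  rcases le_or_gt (dist x₀ x) (growthConstant n lam K G) with hle | hgt
  · rw [max_eq_right (by linarith)]
    simpa using (hw x).1
  rw [max_eq_left (by linarith)]
  have hc3 : 3 ≤ growthConstant n lam K G := by
    have : 0 ≤ (2 * n + |K| + |G| + 1) / lam := by positivity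
    rw [growthConstant]
    linarith
  obtain ⟨γ, hγ0, hγ1, hmin⟩ := (hasAlmostGeodesics n M).exists_isMinimizingNormalGeodesic x₀ x
  set s₀ := dist x₀ x with hs₀
  have hs3 : 3 < s₀ := hc3.trans_lt hgt
  have hdist0 : ∀ s ∈ Icc 0 s₀, dist (γ s) x₀ = s := by
    intro s hs
    rw [← hγ0, hmin s hs 0 ⟨le_rfl, by linarith⟩, sub_zero, abs_of_nonneg hs.1]
  have hsqrt : ∀ s ∈ Icc 0 s₀, ∀ t ∈ Icc 0 s₀,
      |√(f (γ s) + C / lam) - √(f (γ t) + C / lam)| ≤ √(lam / 2) * |s - t| := by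
    intro s hs t ht
    rw [← hmin s hs t ht, dist_comm]
    exact abs_sqrt_sub_sqrt_le h.smooth_potential hlam hF _ _
  obtain ⟨H, hH⟩ : ∃ H : ℝ≥0, LipschitzOnWith H (f ∘ γ) (Icc 0 s₀) := by
    have h1 : LipschitzOnWith (√(lam / 2)).toNNReal (fun s => √(f (γ s) + C / lam)) (Icc 0 s₀) := by
      refine LipschitzOnWith.of_dist_le_mul fun s hs t ht => ?_
      rw [Real.coe_toNNReal _ (Real.sqrt_nonneg _), Real.dist_eq, Real.dist_eq]
      exact hsqrt s hs t ht
    obtain ⟨H, hH⟩ := exists_lipschitzOnWith_mul h1 h1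
    refine ⟨H, LipschitzOnWith.of_dist_le_mul fun s hs t ht => ?_⟩
    have h2 := hH.dist_le_mul s hs t ht
    rw [Real.mul_self_sqrt (hw _).1, Real.mul_self_sqrt (hw _).1, dist_add_right] at h2
    exact h2
  have hE := h.weakHessianEquation (by linarith) hmin hH
  -- the slope at the initial point
  have hinit : ∀ᶠ y in 𝓝 x₀, |f y - f x₀| ≤ (G + 1) * dist x₀ y :=
    eventually_abs_sub_le (n := n)
      (Filter.Eventually.of_forall fun y => (h.smooth_potential y).of_le (by simp)) hG0
      (fun w => (abs_mvfderiv_le_norm_grad_mul f x₀ w).trans (by gcongr)) one_pos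
  obtain ⟨r, hr, hball⟩ := Metric.eventually_nhds_iff_ball.1 hinit
  obtain ⟨ε, hε0, hε1, hεr⟩ : ∃ ε > 0, ε < 1 ∧ ε < r :=
    ⟨min (1 / 2) (r / 2), by positivity, (min_le_left _ _).trans_lt (by norm_num),
      (min_le_right _ _).trans_lt (by linarith)⟩
  have hεm : ε ∈ Icc 0 s₀ := ⟨hε0.le, by linarith⟩
  have hGε : -((G + 1) * ε) ≤ (f ∘ γ) ε - (f ∘ γ) 0 := by
    have h1 := hball (γ ε) (by rw [Metric.mem_ball, hdist0 ε hεm]; exact hεr)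
    rw [dist_comm, hdist0 ε hεm] at h1
    simp only [Function.comp_apply, hγ0]
    exact (abs_le.1 h1).1
  have hbound := mul_sub_two_le_of_weakEquation (n := n) (lam := lam) (s₀ := s₀) (ε := ε)
    (K := |K|) (G := G) (A := √(2 * lam) * √(f x + C / lam)) (H := H)
    (κ := fun s => q (γ s) (velocity (n := n) γ s₀ s) (velocity (n := n) γ s₀ s)) (h := f ∘ γ)
    hlam.le (by linarith) ⟨hε0, hε1⟩ hE.integrableOn_tensor hE.weak_eq ?_ hH ?_ hGε
    ?_
  · have h1 : lam * (s₀ - growthConstant n lam K G) ≤ √(2 * lam) * √(f x + C / lam) := by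
      have h2 : lam * growthConstant n lam K G = 3 * lam + (2 * n + |K| + |G| + 1) := by
        rw [growthConstant]
        field_simp
      rw [abs_of_nonneg hG0] at h2
      linarith
    have h3 := pow_le_pow_left₀ (mul_nonneg hlam.le (by linarith)) h1 2
    rw [mul_pow, mul_pow, Real.sq_sqrt (by positivity), Real.sq_sqrt (hw x).1] at h3
    have h4 : lam * (lam / 2 * (s₀ - growthConstant n lam K G) ^ 2) ≤ lam * (f x + C / lam) := by
      linarith
    exact le_of_mul_le_mul_left h4 hlam
  · intro φ hφL hφ0 hφa hφb
    have h1 := hq s₀ γ (by linarith) hmin φ hφL hφ0 hφa hφb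
    rwa [intervalIntegral.integral_of_le (by linarith),
      intervalIntegral.integral_of_le (by linarith), integral_Ioc_eq_integral_Ioo, integral_Ioc_eq_integral_Ioo] at h1
  · have hsub : Ioo (0 : ℝ) 1 ⊆ Ioo 0 s₀ := Ioo_subset_Ioo_right (by linarith)
    filter_upwards [ae_restrict_of_ae_restrict_of_subset hsub hE.ae_velocity,
      ae_restrict_mem measurableSet_Ioo] with s hs hsI
    have h1 := hK (γ s) (by
      rw [Metric.mem_ball, hdist0 s (Ioo_subset_Icc_self (hsub hsI))]
      exact hsI.2) (velocity (n := n) γ s₀ s)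
    rw [hs.1, one_pow, mul_one] at h1
    exact h1.trans (le_abs_self K)
  · have hsub : Ioo (s₀ - 1) s₀ ⊆ Ioo 0 s₀ := Ioo_subset_Ioo_left (by linarith)
    filter_upwards [ae_restrict_of_ae_restrict_of_subset hsub hE.ae_velocity,
      ae_restrict_mem measurableSet_Ioo] with s hs hsI
    have h1 := hsqrt s (Ioo_subset_Icc_self (hsub hsI)) s₀ ⟨by linarith, le_rfl⟩
    rw [hγ1, abs_sub_comm s s₀,
      abs_of_nonneg (show 0 ≤ s₀ - s by linarith [hsI.2])] at h1
    have h2 : √(f (γ s) + C / lam) ≤ √(f x + C / lam) + √(lam / 2) * (s₀ - s) := by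
      linarith [(abs_le.1 h1).2]
    have h3 : √(2 * lam) * √(lam / 2) = lam := by
      rw [← Real.sqrt_mul (by positivity), show 2 * lam * (lam / 2) = lam ^ 2 by ring,
        Real.sqrt_sq hlam.le]
    rw [hs.2.deriv]
    calc |inner ℝ (grad (n := n) f (γ s)) (velocity (n := n) γ s₀ s)|
        ≤ ‖grad (n := n) f (γ s)‖ * ‖velocity (n := n) γ s₀ s‖ := abs_real_inner_le_norm _ _
      _ = ‖grad (n := n) f (γ s)‖ := by rw [hs.1, mul_one]
      _ ≤ √(2 * lam) * √(f (γ s) + C / lam) := (hw _).2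
      _ ≤ √(2 * lam) * (√(f x + C / lam) + √(lam / 2) * (s₀ - s)) := by gcongr
      _ = √(2 * lam) * √(f x + C / lam) + lam * (s₀ - s) := by
        rw [mul_add, ← mul_assoc, h3]

/-- The potential has a minimum, because the growth estimate makes it a proper function. -/
lemma IsGradientQSoliton.exists_forall_le [ProperSpace M] [Nonempty M]
    (h : IsGradientQSoliton q f lam)
    (hlam : 0 < lam) (hF : ∀ x, (1 / 2) * ‖grad (n := n) f x‖ ^ 2 - lam * f x ≤ C)
    (hq : IntegralInequality q) : ∃ x₀, ∀ x, f x₀ ≤ f x := by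
  obtain ⟨p⟩ := ‹Nonempty M›
  obtain ⟨K, hK⟩ := h.exists_boundedOnUnitBall p
  have hgr := h.growth hlam hF hq hK le_rfl
  set c := growthConstant n lam K ‖grad (n := n) f p‖
  have hw : 0 ≤ f p + C / lam := (norm_grad_le_sqrt hlam hF p).1
  refine h.smooth_potential.continuous.exists_forall_le' p ?_
  filter_upwards [(isCompact_closedBall p (c + √(2 / lam * (f p + C / lam)))).compl_mem_cocompact]
    with x hx
  rw [mem_compl_iff, Metric.mem_closedBall, not_le] at hx
  have h1 : √(2 / lam * (f p + C / lam)) ≤ max (dist x p - c) 0 :=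
    le_max_of_le_left (by linarith)
  have h2 := pow_le_pow_left₀ (Real.sqrt_nonneg _) h1 2
  rw [Real.sq_sqrt (by positivity)] at h2
  have h3 := mul_le_mul_of_nonneg_left h2 (show 0 ≤ lam / 2 by positivity)
  have h4 : lam / 2 * (2 / lam * (f p + C / lam)) = f p + C / lam := by field_simp
  linarith [hgr x]

end Growth

end QSoliton

end

theorem proposition4p2 (n : ℕ) (lam : ℝ) (hlam : 0 < lam) :
    ∃ c₁ : ℝ → ℝ → ℝ, (∀ K G, 0 < c₁ K G) ∧
      ∀ (M : Type u) [MetricSpace M] [ChartedSpace (EuclideanSpace ℝ (Fin n)) M]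
        [IsManifold (𝓡 n) ∞ M]
        [RiemannianBundle (fun x : M => TangentSpace (𝓡 n) x)]
        [IsContMDiffRiemannianBundle (𝓡 n) ∞ (EuclideanSpace ℝ (Fin n))
          (fun x : M => TangentSpace (𝓡 n) x)]
        [IsRiemannianManifold (𝓡 n) M]
        [ConnectedSpace M] [CompleteSpace M] [NoncompactSpace M]
        (q : Π x : M, TangentSpace (𝓡 n) x →L[ℝ] TangentSpace (𝓡 n) x →L[ℝ] ℝ)
        (f : M → ℝ) (C : ℝ),
        QSoliton.IsGradientQSoliton q f lam →
        (∀ x, (1 / 2) * ‖QSoliton.grad (n := n) f x‖ ^ 2 - lam * f x ≤ C) →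
        QSoliton.IntegralInequality q →
        (∀ (x₀ : M) (K G : ℝ), QSoliton.BoundedOnUnitBall q x₀ K →
          ‖QSoliton.grad (n := n) f x₀‖ ≤ G →
          ∀ x, lam / 2 * (max (dist x x₀ - c₁ K G) 0) ^ 2 ≤ f x + C / lam) ∧
        (∃ x₀ : M, (∀ x, f x₀ ≤ f x) ∧
          ∀ K : ℝ, QSoliton.BoundedOnUnitBall q x₀ K →
            ∀ x, lam / 2 * (max (dist x x₀ - c₁ K 0) 0) ^ 2 ≤ f x + C / lam) := by
  refine ⟨QSoliton.growthConstant n lam, fun K G => ?_, ?_⟩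
  · rw [QSoliton.growthConstant]
    positivity
  intro M _ _ _ _ _ _ _ _ _ q f C hsol hF hq
  have : LocallyCompactSpace M := ChartedSpace.locallyCompactSpace (EuclideanSpace ℝ (Fin n)) M
  have : ProperSpace M := (QSoliton.hasAlmostGeodesics n M).properSpace
  refine ⟨fun x₀ K G hK hG => hsol.growth hlam hF hq hK hG, ?_⟩
  obtain ⟨x₀, hx₀⟩ := hsol.exists_forall_le hlam hF hq
  refine ⟨x₀, hx₀, fun K hK => hsol.growth hlam hF hq hK ?_⟩
  rw [QSoliton.grad_eq_zero_of_isLocalMin (hsol.smooth_potential.mdifferentiable (by simp) x₀)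
    (Filter.Eventually.of_forall hx₀), norm_zero]
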